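/- Let $2\le m<n$ be integers, let $D\subseteq\{0,\dots,m-1\}\times\{0,\dots,n-1\}$ with $|D|\ge 2$, and put $\sigma=\log m/\log n$. For $(i,j)\in D$ let $T_{i,j}(x,y)=\left(\frac{x+j}{n},\frac{y+i}{m}\right)$, and let $\Lambda\subset\mathbb R^2$ be the Bedford–McMullen carpet, i.e. the unique non-empty compact set with $\Lambda=\bigcup_{(i,j)\in D}T_{i,j}(\Lambda)$; equivalently, $\Lambda$ is the set of points $\left(\sum_{k\ge1}j_kn^{-k},\sum_{k\ge1}i_km^{-k}\right)$ with $(i_k,j_k)\in D$ for all $k$. Let $L_0=|D|$, let $n_i$ be the number of $j$ with $(i,j)\in D$, and let $L_1$ be the number of $i$ with $n_i\neq0$. Let $(p_{ij})_{(i,j)\in D}$ be a probability vector with all $p_{ij}>0$, let $\mu$ be the Bernoulli measure on $\Lambda$, i.e. the unique Borel probability measure with $\mu(B)=\sum_{(i,j)\in D}p_{ij}\,\mu(T_{i,j}^{-1}B)$ for all Borel sets $B$, and let $q_i=\sum_jp_{ij}$. For every $x\in\Lambda$ fix a symbolic expansion $(i_k(x),j_k(x))_{k\ge1}\in D^{\mathbb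 N}$ of $x$ (any choice is allowed where there are several), and let $C_N(x)$ be the approximate square consisting of all $y\in\Lambda$ with $i_k(y)=i_k(x)$ for all $k\le N$ and $j_k(y)=j_k(x)$ for all $k\le\lceil\sigma N\rceil$. For $\alpha\in\mathbb R$ let $$X_\alpha=\left\{x\in\Lambda:\lim_{r\to0}\frac{\log\mu(B_r(x))}{\log r}=\alpha\right\},\qquad X_\alpha^{\rm symb}=\left\{x\in\Lambda:\lim_{N\to\infty}\frac{\log\mu(C_N(x))}{-N\log m}=\alpha\right\}.$$ Let $\dim_P$ denote packing dimension, with $\dim_P\emptyset=0$. In the sums below, $i$ runs over the rows with $n_i\ne0$. **Theorem 2.3.** (a) If $$\sum_i\frac1{L_1}\log q_i\neq\sum_i\frac{n_i}{L_0}\log q_i ,$$ then $$\sup_{\alpha\in\mathbb R}\dim_PX_\alpha^{\rm symb}<\dim_P\Lambda\qquad\text{and}\qquad\sup_{\alpha\in\mathbb R}\dim_PX_\alpha<\dim_P\Lambda .$$ (b) If $$\sum_i\frac1{L_1}\log q_i=\sum_i\frac{n_i}{L_0}\log q_i=A\qquad\text{and}\qquad\sum_{(i,j)\in D}\frac1{L_0}\log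 p_{ij}=\sum_{(i,j)\in D}\frac1{n_iL_1}\log p_{ij}=B,$$ then $\dim_PX_{\alpha_0}^{\rm symb}=\dim_PX_{\alpha_0}=\dim_P\Lambda$ for $$\alpha_0=-\frac1{\log m}\bigl(\sigma B+(1-\sigma)A\bigr).$$ -/

import Mathlib

open MeasureTheory Filter Topology Set
open scoped ENNReal NNReal

/-! ### Packing measure and packing dimension -/

section Packing

variable {E : Type*} [MetricSpace E]

/-- `C` is the (countable) set of centres, and `r` gives the radii, of a packing of `A` by pairwise
disjoint balls centred in `A` and of radii in `(0, ε)`. -/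
structure IsPacking (A : Set E) (ε : ℝ) (C : Set E) (r : E → ℝ) : Prop where
  countable : C.Countable
  subset : C ⊆ A
  pos : ∀ x ∈ C, 0 < r x
  lt : ∀ x ∈ C, r x < ε
  separated : C.Pairwise fun x y => r x + r y < dist x y

/-- The `s`-dimensional packing premeasure: the limit as `ε ↓ 0` of the supremum of `∑ (2 rᵢ) ^ s`
over all packings of `A` by balls of radii less than `ε` (a monotone limit, hence an infimum). -/
noncomputable def packingPre (s : ℝ≥0) (A : Set E) : ℝ≥0∞ :=
  ⨅ (ε : ℝ) (_ : 0 < ε), ⨆ (C : Set E) (r : E → ℝ) (_ : IsPacking A ε C r),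
    ∑' x : C, ENNReal.ofReal (2 * r x) ^ (s : ℝ)

/-- The `s`-dimensional packing (outer) measure. -/
noncomputable def packingMeasure (s : ℝ≥0) (A : Set E) : ℝ≥0∞ :=
  ⨅ (F : ℕ → Set E) (_ : A ⊆ ⋃ i, F i), ∑' i, packingPre s (F i)

/-- The packing dimension, `inf {s ≥ 0 : 𝒫ˢ(A) = 0}`. -/
noncomputable def dimP (A : Set E) : ℝ≥0∞ :=
  ⨅ (s : ℝ≥0) (_ : packingMeasure s A = 0), (s : ℝ≥0∞)

end Packing

/-! ### Bedford-McMullen carpets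

The digits are pairs `(i, j)`, with `i` the row (vertical position, `m` rows) and `j` the column
(horizontal position, `n` columns). Symbols of a sequence are numbered from `0`. -/

/-- The affine contraction `(x, y) ↦ ((x + j) / n, (y + i) / m)`. -/
noncomputable def carpetMap {m n : ℕ} (d : Fin m × Fin n) (z : EuclideanSpace ℝ (Fin 2)) :
    EuclideanSpace ℝ (Fin 2) :=
  !₂[(z 0 + (d.2 : ℝ)) / n, (z 1 + (d.1 : ℝ)) / m]

/-- The natural projection from the symbolic space `D ^ ℕ` to the plane. -/
noncomputable def codingMap {m n : ℕ} (D : Finset (Fin m × Fin n)) (ω : ℕ → D) :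
    EuclideanSpace ℝ (Fin 2) :=
  !₂[∑' k, ((ω k).1.2 : ℝ) / (n : ℝ) ^ (k + 1), ∑' k, ((ω k).1.1 : ℝ) / (m : ℝ) ^ (k + 1)]

/-- The carpet `Λ`, as the set of all points that have a symbolic expansion. The lemmas
`carpet_nonempty`, `isCompact_carpet`, `carpet_eq_iUnion` show that it is a non-empty compact set
invariant under the iterated function system (there is only one such set). -/
noncomputable def carpet {m n : ℕ} (D : Finset (Fin m × Fin n)) : Set (EuclideanSpace ℝ (Fin 2)) :=
  range (codingMap D)

section Facts

variable {m n : ℕ} {D : Finset (Fin m × Fin n)}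

theorem digit_le {b : ℕ} (a : Fin b) (k : ℕ) :
    ‖(a : ℝ) / (b : ℝ) ^ (k + 1)‖ ≤ (1 / (b : ℝ)) ^ k := by
  have hb : (0 : ℝ) < b := by exact_mod_cast a.pos
  have ha : (a : ℝ) ≤ b := by exact_mod_cast a.2.le
  rw [Real.norm_of_nonneg (by positivity), one_div, inv_pow, pow_succ, div_le_iff₀ (by positivity)]
  field_simp
  exact ha

theorem summable_geo {b : ℕ} (hb : 2 ≤ b) : Summable fun k : ℕ => (1 / (b : ℝ)) ^ k := by
  have hb' : (2 : ℝ) ≤ b := by exact_mod_cast hb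
  apply summable_geometric_of_lt_one (by positivity)
  rw [div_lt_one (by linarith)]
  linarith

theorem tsum_digits {b : ℕ} (hb : 2 ≤ b) (a : ℕ → Fin b) :
    ∑' k, (a k : ℝ) / (b : ℝ) ^ (k + 1) =
      ((∑' k, (a (k + 1) : ℝ) / (b : ℝ) ^ (k + 1)) + a 0) / b := by
  have hb' : (b : ℝ) ≠ 0 := by positivity
  have hs : Summable fun k => (a k : ℝ) / (b : ℝ) ^ (k + 1) :=
    (summable_geo hb).of_norm_bounded fun k => digit_le (a k) k
  rw [hs.tsum_eq_zero_add, add_div, ← tsum_div_const, add_comm]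
  congr 1
  · exact tsum_congr fun k => by rw [div_div, ← pow_succ]
  · simp

theorem continuous_codingMap (hm : 2 ≤ m) (hn : 2 ≤ n) : Continuous (codingMap D) := by
  refine (PiLp.continuous_toLp 2 _).comp (continuous_pi fun c => ?_)
  fin_cases c
  · refine continuous_tsum (fun k => ?_) (summable_geo hn) fun k ω => digit_le (ω k).1.2 k
    exact (continuous_of_discreteTopology (f := fun d : D => (d.1.2 : ℝ) / (n : ℝ) ^ (k + 1))).comp
      (continuous_apply k)
  · refine continuous_tsum (fun k => ?_) (summable_geo hm) fun k ω => digit_le (ω k).1.1 k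
    exact (continuous_of_discreteTopology (f := fun d : D => (d.1.1 : ℝ) / (m : ℝ) ^ (k + 1))).comp
      (continuous_apply k)

theorem codingMap_eq (hm : 2 ≤ m) (hn : 2 ≤ n) (ω : ℕ → D) :
    codingMap D ω = carpetMap (ω 0).1 (codingMap D fun k => ω (k + 1)) := by
  unfold codingMap carpetMap
  ext c
  fin_cases c
  · simpa using tsum_digits hn fun k => (ω k).1.2
  · simpa using tsum_digits hm fun k => (ω k).1.1

theorem carpet_nonempty (hD : D.Nonempty) : (carpet D).Nonempty := by
  obtain ⟨d, hd⟩ := hD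
  exact ⟨_, fun _ => ⟨d, hd⟩, rfl⟩

theorem isCompact_carpet (hm : 2 ≤ m) (hn : 2 ≤ n) : IsCompact (carpet D) :=
  isCompact_range (continuous_codingMap hm hn)

theorem carpet_eq_iUnion (hm : 2 ≤ m) (hn : 2 ≤ n) :
    carpet D = ⋃ d ∈ D, carpetMap d '' carpet D := by
  ext z
  simp only [mem_iUnion, mem_image, carpet, mem_range]
  constructor
  · rintro ⟨ω, rfl⟩
    exact ⟨(ω 0).1, (ω 0).2, _, ⟨_, rfl⟩, (codingMap_eq hm hn ω).symm⟩
  · rintro ⟨d, hd, _, ⟨ω, rfl⟩, rfl⟩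
    refine ⟨fun k => k.casesOn ⟨d, hd⟩ ω, ?_⟩
    exact codingMap_eq hm hn _

end Facts

/-! ### Bernoulli measures and local dimensions -/

/-- The Bernoulli measure on the carpet: the image under the natural projection of the product
measure on `D ^ ℕ` given by the probability vector `p`. By `continuous_codingMap` the projection
is measurable. -/
noncomputable def bernoulliMeasure {m n : ℕ} (D : Finset (Fin m × Fin n)) (p : PMF D) :
    Measure (EuclideanSpace ℝ (Fin 2)) :=
  (Measure.infinitePi fun _ : ℕ => p.toMeasure).map (codingMap D)

theorem isProbabilityMeasure_bernoulliMeasure {m n : ℕ} {D : Finset (Fin m × Fin n)} (hm : 2 ≤ m)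
    (hn : 2 ≤ n) (p : PMF D) : IsProbabilityMeasure (bernoulliMeasure D p) :=
  Measure.isProbabilityMeasure_map (continuous_codingMap hm hn).measurable.aemeasurable

/-- The Bernoulli measure is the self-affine measure: `μ(B) = ∑ p_d μ(T_d⁻¹ B)`. -/
theorem bernoulliMeasure_apply {m n : ℕ} {D : Finset (Fin m × Fin n)} (hm : 2 ≤ m)
    (hn : 2 ≤ n) (p : PMF D) {B : Set (EuclideanSpace ℝ (Fin 2))} (hB : MeasurableSet B) :
    bernoulliMeasure D p B = ∑ d : D, p d * bernoulliMeasure D p (carpetMap d.1 ⁻¹' B) := by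
  have hcod := (continuous_codingMap (D := D) hm hn).measurable
  have hT : ∀ d : D, Measurable (carpetMap (m := m) (n := n) d.1) := fun d => by
    refine Continuous.measurable ((PiLp.continuous_toLp 2 _).comp (continuous_pi fun c => ?_))
    fin_cases c <;> simp <;> fun_prop
  let cons : D × (ℕ → D) → ℕ → D := fun x k => k.casesOn x.1 x.2
  have hc : Measurable cons := by
    refine measurable_pi_lambda _ fun k => ?_
    cases k with
    | zero => exact measurable_fst
    | succ k => exact (measurable_pi_apply k).comp measurable_snd
  have key : (p.toMeasure.prod (Measure.infinitePi fun _ : ℕ => p.toMeasure)).map cons =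
      Measure.infinitePi fun _ : ℕ => p.toMeasure := by
    classical
    refine Measure.eq_infinitePi _ fun s t ht => ?_
    obtain ⟨N, hN⟩ : ∃ N, s ⊆ Finset.range (N + 1) :=
      ⟨s.sup id, fun k hk => Finset.mem_range.2 (Nat.lt_succ_of_le (Finset.le_sup (f := id) hk))⟩
    let u : ℕ → Set D := fun k => if k ∈ s then t k else univ
    have hu : ∀ k, MeasurableSet (u k) := fun k => by
      simp only [u]; split_ifs
      exacts [ht k, MeasurableSet.univ]
    have hpi : (s : Set ℕ).pi t = (Finset.range (N + 1) : Set ℕ).pi u := by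
      ext ω
      simp only [Set.mem_pi, Finset.mem_coe]
      constructor
      · intro h k _
        by_cases hk : k ∈ s <;> simp [u, hk]
        exact h k hk
      · intro h k hk
        simpa [u, hk] using h k (hN hk)
    have hprod : ∏ k ∈ s, p.toMeasure (t k) = ∏ k ∈ Finset.range (N + 1), p.toMeasure (u k) := by
      rw [← Finset.prod_subset hN]
      · exact Finset.prod_congr rfl fun k hk => by simp [u, hk]
      · intro k _ hk
        simp [u, hk]
    have hpre : cons ⁻¹' (Finset.range (N + 1) : Set ℕ).pi u =
        u 0 ×ˢ (Finset.range N : Set ℕ).pi fun k => u (k + 1) := by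
      ext ⟨d, ω⟩
      simp only [mem_preimage, Set.mem_pi, Finset.mem_coe, Finset.mem_range, mem_prod]
      constructor
      · exact fun h => ⟨h 0 (by omega), fun k hk => h (k + 1) (by omega)⟩
      · rintro ⟨h0, h1⟩ k hk
        cases k with
        | zero => exact h0
        | succ k => exact h1 k (by omega)
    rw [hpi, hprod, Measure.map_apply hc
      (MeasurableSet.pi (Finset.countable_toSet _) fun k _ => hu k), hpre, Measure.prod_prod,
      Measure.infinitePi_pi _ fun k _ => hu (k + 1), Finset.prod_range_succ', mul_comm]
  have hcomp : ∀ d ω, codingMap D (cons (d, ω)) = carpetMap d.1 (codingMap D ω) := fun d ω =>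
    codingMap_eq hm hn _
  rw [bernoulliMeasure, Measure.map_apply hcod hB]
  nth_rw 1 [← key]
  rw [Measure.map_apply hc (hcod hB), Measure.prod_apply (hc (hcod hB)), lintegral_fintype]
  refine Finset.sum_congr rfl fun d _ => ?_
  rw [p.toMeasure_apply_singleton d (measurableSet_singleton d), mul_comm,
    Measure.map_apply hcod (hT d hB)]
  congr 2
  ext ω
  simp [hcomp]

/-- The ratio `σ = log m / log n`. -/
noncomputable def sigma (m n : ℕ) : ℝ := Real.log m / Real.log n

/-- The rectangle `R^{n₁,n₂}(x)`: the points of the carpet whose symbolic expansion has the same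
first `n₂` row symbols and the same first `n₁` column symbols as that of `x`. The map `code`
assigns to each point of the carpet its symbolic expansion. -/
def rectangle {m n : ℕ} (D : Finset (Fin m × Fin n)) (code : EuclideanSpace ℝ (Fin 2) → ℕ → D)
    (n₁ n₂ : ℕ) (x : EuclideanSpace ℝ (Fin 2)) : Set (EuclideanSpace ℝ (Fin 2)) :=
  {y ∈ carpet D | (∀ k < n₂, (code y k).1.1 = (code x k).1.1) ∧
    ∀ k < n₁, (code y k).1.2 = (code x k).1.2}

/-- The approximate square `C_N(x) = R^{⌈σN⌉,N}(x)` of level `N`. -/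
noncomputable def approxSquare {m n : ℕ} (D : Finset (Fin m × Fin n))
    (code : EuclideanSpace ℝ (Fin 2) → ℕ → D) (N : ℕ) (x : EuclideanSpace ℝ (Fin 2)) :
    Set (EuclideanSpace ℝ (Fin 2)) :=
  rectangle D code ⌈sigma m n * N⌉₊ N x

/-- `X_α`: the points of the carpet at which the (real) local dimension exists and equals `α`. -/
def realLevelSet {m n : ℕ} (D : Finset (Fin m × Fin n)) (p : PMF D) (α : ℝ) :
    Set (EuclideanSpace ℝ (Fin 2)) :=
  {x ∈ carpet D | Tendsto
    (fun r : ℝ => Real.log ((bernoulliMeasure D p).real (Metric.closedBall x r)) / Real.log r)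
    (𝓝[>] 0) (𝓝 α)}

/-- `X_α^symb`: the points of the carpet at which the symbolic local dimension exists and
equals `α`. -/
def symbLevelSet {m n : ℕ} (D : Finset (Fin m × Fin n)) (p : PMF D)
    (code : EuclideanSpace ℝ (Fin 2) → ℕ → D) (α : ℝ) : Set (EuclideanSpace ℝ (Fin 2)) :=
  {x ∈ carpet D | Tendsto
    (fun N : ℕ => Real.log ((bernoulliMeasure D p).real (approxSquare D code N x)) / (-N * Real.log m))
    atTop (𝓝 α)}

/-! ### Row data -/

/-- The set of non-empty rows; its cardinality is `L₁`. -/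
def rows {m n : ℕ} (D : Finset (Fin m × Fin n)) : Finset (Fin m) := D.image Prod.fst

/-- `n_i`, the number of digits in row `i`. -/
def rowCount {m n : ℕ} (D : Finset (Fin m × Fin n)) (i : Fin m) : ℕ :=
  (D.filter fun d => d.1 = i).card

/-- `q_i = ∑_j p_{ij}`, the probability of row `i`. -/
noncomputable def rowProb {m n : ℕ} {D : Finset (Fin m × Fin n)} (p : PMF D) (i : Fin m) : ℝ :=
  ∑ d : D, if d.1.1 = i then (p d).toReal else 0

/-!
Approximate squares of level `N` are given by `⌈σN⌉` digits of `D` followed by `N - ⌈σN⌉` non-empty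
rows, so their number grows like `exp (N E)`, with `E = σ log L₀ + (1 - σ) log L₁`
(`squareEntropy`). The packing dimension of the carpet is `E / log m`.

The upper bound is a count of squares (`dimP_le_of_eventually_mem`). More generally, a set of points
whose codes eventually belong to a family of squares that is smaller by the factor `exp (-c N)` has
dimension at most `(E - c) / log m`. Squares are counted with the help of the product measure that
gives equal mass to all squares of level `N`: digits uniform in `D` before the place `⌈σN⌉`, and
digits with uniformly distributed rows (`rowUniform`) from then on.

The lower bound (`le_dimP_image`) comes from the mass distribution principle for packing measures
(`measure_le_packingMeasure`), which looks at a sequence of scales only. Along sparse levels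
`N = (j + 1)!` a single product measure can imitate the equidistribution on the squares of level
`N`: its digits are uniform in `D` on the block from `j!` to `⌈σN⌉`, and have uniform rows on the
block from `⌈σN⌉` to `N`.

The logarithm of the Bernoulli measure of an approximate square is a sum of independent bounded
functions of the digits (`squareLog`). If the means of `log p` and of `log q` are the same for
uniform digits and for digits with uniform rows, the law of large numbers shows that almost every
point, for the measure of the lower bound, has the local dimension `α₀`; its level set therefore
has full dimension. If the two means of `log q` differ, compare the scales `N` and `⌈σN⌉`. In a
typical square of level `N`, the rows after the place `⌈σN⌉` have the mean of uniform rows, while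
the rows between `⌈σ⌈σN⌉⌉` and `⌈σN⌉`, which matter at the scale `⌈σN⌉`, have the mean of uniform
digits. The two local exponents then differ by a fixed amount (`eventually_gap`), which is impossible
for large `N` in a level set, whatever `α` is. So the codes of the points of a level set are
eventually atypical, and by Hoeffding's inequality atypical squares are exponentially rare
(`exists_atypical_bound`), uniformly in `α`.

Balls are compared with squares through `Spread`: a point without long runs of a row or of a column
after the places that define its square of level `N` is far from the boundary of this square
(`mem_symbSquare_of_dist_lt`). Long runs are exponentially rare for all the measures involved. The
same argument shows that points with several codes are negligible (`ae_code_unique`), so that the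
choice of the codes does not matter.
-/

/-! ### Expansions in an integer base -/

section Digits

variable {b : ℕ}

/-- The number in `[0, 1]` with the base `b` digits `a 0, a 1, …`. -/
noncomputable def digitValue (a : ℕ → Fin b) : ℝ := ∑' k, (a k : ℝ) / (b : ℝ) ^ (k + 1)

theorem summable_digits (hb : 2 ≤ b) (a : ℕ → Fin b) :
    Summable fun k => (a k : ℝ) / (b : ℝ) ^ (k + 1) :=
  (summable_geo hb).of_norm_bounded fun k => digit_le (a k) k

theorem digitValue_nonneg (a : ℕ → Fin b) : 0 ≤ digitValue a :=
  tsum_nonneg fun _ => by positivity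

theorem digitValue_succ (hb : 2 ≤ b) (a : ℕ → Fin b) :
    digitValue a = (digitValue (fun k => a (k + 1)) + a 0) / b :=
  tsum_digits hb a

theorem digitValue_rev (hb : 2 ≤ b) (a : ℕ → Fin b) :
    digitValue (fun k => (a k).rev) = 1 - digitValue a := by
  have hb' : (2 : ℝ) ≤ b := by exact_mod_cast hb
  have h1 : HasSum (fun k : ℕ => ((b : ℝ) - 1) / (b : ℝ) ^ (k + 1)) 1 := by
    have hb1 : (b : ℝ) - 1 ≠ 0 := by linarith
    have hsum := (hasSum_geometric_of_lt_one (r := 1 / (b : ℝ)) (by positivity)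
      (by rw [div_lt_one (by linarith)]; linarith)).mul_left (((b : ℝ) - 1) / b)
    have hval : ((b : ℝ) - 1) / b * (1 - 1 / (b : ℝ))⁻¹ = 1 := by
      field_simp
    rw [hval] at hsum
    refine hsum.congr_fun fun k => ?_
    rw [pow_succ, div_pow, one_pow]
    field_simp
  rw [eq_sub_iff_add_eq, digitValue, digitValue,
    ← (summable_digits hb fun k => (a k).rev).tsum_add (summable_digits hb a), ← h1.tsum_eq]
  refine tsum_congr fun k => ?_
  rw [← add_div, Fin.val_rev, Nat.cast_sub (a k).2]
  push_cast
  ring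

theorem digitValue_le_one (hb : 2 ≤ b) (a : ℕ → Fin b) : digitValue a ≤ 1 := by
  have := digitValue_rev hb a
  linarith [digitValue_nonneg fun k => (a k).rev]

theorem le_digitValue (hb : 2 ≤ b) {a : ℕ → Fin b} {k K : ℕ} (hk : k < K)
    (ha : (a k : ℕ) ≠ 0) : 1 / (b : ℝ) ^ K ≤ digitValue a := by
  have hb' : (2 : ℝ) ≤ b := by exact_mod_cast hb
  have h1 : (1 : ℝ) ≤ (a k : ℕ) := by exact_mod_cast Nat.one_le_iff_ne_zero.2 ha
  calc 1 / (b : ℝ) ^ K ≤ 1 / (b : ℝ) ^ (k + 1) := by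
        gcongr
        · linarith
        · exact hk
    _ ≤ (a k : ℝ) / (b : ℝ) ^ (k + 1) := by gcongr
    _ ≤ digitValue a := (summable_digits hb a).le_tsum k fun _ _ => by positivity

theorem abs_digitValue_sub_le (hb : 2 ≤ b) (N : ℕ) (a c : ℕ → Fin b)
    (h : ∀ k < N, a k = c k) : |digitValue a - digitValue c| ≤ 1 / (b : ℝ) ^ N := by
  induction N generalizing a c with
  | zero =>
    rw [pow_zero, div_one, abs_le]
    constructor <;> linarith [digitValue_nonneg a, digitValue_nonneg c, digitValue_le_one hb a,
      digitValue_le_one hb c]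
  | succ N ih =>
    have hb' : (0 : ℝ) < b := by positivity
    have := ih (fun k => a (k + 1)) (fun k => c (k + 1)) fun k hk => h (k + 1) (by omega)
    rw [digitValue_succ hb a, digitValue_succ hb c, h 0 (by omega), ← sub_div, add_sub_add_right_eq_sub,
      abs_div, abs_of_pos hb', pow_succ, ← div_div]
    gcongr

/-- Expansions that differ before place `N` have values at least `b ^ -(N + l)` apart, if one of
them is not constant between the places `N` and `N + l`: such an expansion stays away from the
end points of the `b`-adic interval of level `N`. -/
theorem le_abs_digitValue_sub (hb : 2 ≤ b) (N l : ℕ) (a c : ℕ → Fin b)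
    (hrun : ∃ k ∈ Ico N (N + l), ∃ k' ∈ Ico N (N + l), a k ≠ a k')
    (hne : ∃ k < N, a k ≠ c k) : 1 / (b : ℝ) ^ (N + l) ≤ |digitValue a - digitValue c| := by
  induction N generalizing a c with
  | zero => simp at hne
  | succ N ih =>
    have hb' : (0 : ℝ) < b := by positivity
    obtain ⟨k, hk, k', hk', hkk⟩ := hrun
    rw [mem_Ico] at hk hk'
    obtain ⟨k, rfl⟩ : ∃ j, k = j + 1 := ⟨k - 1, by omega⟩
    obtain ⟨k', rfl⟩ : ∃ j, k' = j + 1 := ⟨k' - 1, by omega⟩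
    rw [digitValue_succ hb a, digitValue_succ hb c, ← sub_div, abs_div, abs_of_pos hb',
      add_right_comm, pow_succ, ← div_div]
    gcongr
    set a' := fun k => a (k + 1)
    set c' := fun k => c (k + 1)
    have hk1 : k < N + l := by omega
    have hk2 : k' < N + l := by omega
    rcases lt_trichotomy (a 0 : ℕ) (c 0 : ℕ) with h0 | h0 | h0
    · have h0' : (a 0 : ℝ) + 1 ≤ c 0 := by exact_mod_cast h0
      have key : 1 / (b : ℝ) ^ (N + l) ≤ 1 - digitValue a' := by
        rw [← digitValue_rev hb]
        by_cases hz : ((a' k).rev : ℕ) = 0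
        · refine le_digitValue hb hk2 fun hz' => hkk (Fin.rev_injective (Fin.ext ?_))
          exact hz.trans hz'.symm
        · exact le_digitValue hb hk1 hz
      rw [abs_sub_comm]
      refine le_trans ?_ (le_abs_self _)
      linarith [digitValue_nonneg c']
    · have h0' : a 0 = c 0 := Fin.ext h0
      rw [h0', add_sub_add_right_eq_sub]
      refine ih a' c' ⟨k, by simp; omega, k', by simp; omega, hkk⟩ ?_
      obtain ⟨i, hi, hne⟩ := hne
      cases i with
      | zero => exact absurd h0' hne
      | succ i => exact ⟨i, by omega, hne⟩
    · have h0' : (c 0 : ℝ) + 1 ≤ a 0 := by exact_mod_cast h0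
      have key : 1 / (b : ℝ) ^ (N + l) ≤ digitValue a' := by
        by_cases hz : (a' k : ℕ) = 0
        · refine le_digitValue hb hk2 fun hz' => hkk (Fin.ext (hz.trans hz'.symm))
        · exact le_digitValue hb hk1 hz
      refine le_trans ?_ (le_abs_self _)
      linarith [digitValue_le_one hb c']

end Digits

/-! ### Approximate squares in the symbolic space -/

section Squares

variable {m n : ℕ} {D : Finset (Fin m × Fin n)}

theorem sigma_pos (hm : 2 ≤ m) (hmn : m < n) : 0 < sigma m n :=
  div_pos (Real.log_pos (by exact_mod_cast hm)) (Real.log_pos (by exact_mod_cast (by omega : 1 < n)))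

theorem sigma_lt_one (hm : 2 ≤ m) (hmn : m < n) : sigma m n < 1 := by
  rw [sigma, div_lt_one (Real.log_pos (by exact_mod_cast (by omega : 1 < n)))]
  exact Real.log_lt_log (by positivity) (by exact_mod_cast hmn)

theorem sigma_mul_log (hm : 2 ≤ m) (hmn : m < n) : sigma m n * Real.log n = Real.log m :=
  div_mul_cancel₀ _ (Real.log_pos (by exact_mod_cast (by omega : 1 < n))).ne'

/-- The number `⌈σN⌉` of columns that are prescribed in an approximate square of level `N`. -/
noncomputable def colLevel (m n N : ℕ) : ℕ := ⌈sigma m n * N⌉₊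

theorem le_colLevel (N : ℕ) : sigma m n * N ≤ colLevel m n N := Nat.le_ceil _

theorem colLevel_lt (hm : 2 ≤ m) (hmn : m < n) (N : ℕ) : (colLevel m n N : ℝ) < sigma m n * N + 1 :=
  Nat.ceil_lt_add_one (mul_nonneg (sigma_pos hm hmn).le N.cast_nonneg)

theorem colLevel_le (hm : 2 ≤ m) (hmn : m < n) (N : ℕ) : colLevel m n N ≤ N :=
  Nat.ceil_le.2 (mul_le_of_le_one_left N.cast_nonneg (sigma_lt_one hm hmn).le)

theorem colLevel_mono (hm : 2 ≤ m) (hmn : m < n) : Monotone (colLevel m n) := fun _ _ h =>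
  Nat.ceil_mono (mul_le_mul_of_nonneg_left (by exact_mod_cast h) (sigma_pos hm hmn).le)

theorem tendsto_colLevel_div (hm : 2 ≤ m) (hmn : m < n) :
    Tendsto (fun N : ℕ => (colLevel m n N : ℝ) / N) atTop (𝓝 (sigma m n)) :=
  (tendsto_nat_ceil_mul_div_atTop (sigma_pos hm hmn).le).comp tendsto_natCast_atTop_atTop

theorem tendsto_colLevel (hm : 2 ≤ m) (hmn : m < n) : Tendsto (colLevel m n) atTop atTop :=
  tendsto_nat_ceil_atTop.comp
    (tendsto_natCast_atTop_atTop.const_mul_atTop (sigma_pos hm hmn))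

/-- The digits allowed at place `k` in the approximate square of level `N` around `ω`. -/
def cell (N : ℕ) (ω : ℕ → D) (k : ℕ) : Set D :=
  {d | if k < colLevel m n N then d = ω k else d.1.1 = (ω k).1.1}

/-- The symbolic approximate square of level `N` around `ω`. -/
def symbSquare (N : ℕ) (ω : ℕ → D) : Set (ℕ → D) :=
  (Finset.range N : Set ℕ).pi (cell N ω)

theorem mem_symbSquare (hm : 2 ≤ m) (hmn : m < n) {N : ℕ} {ω τ : ℕ → D} :
    τ ∈ symbSquare N ω ↔ (∀ k < N, (τ k).1.1 = (ω k).1.1) ∧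
      ∀ k < colLevel m n N, (τ k).1.2 = (ω k).1.2 := by
  have hle := colLevel_le hm hmn N
  simp only [symbSquare, cell, Set.mem_pi, Finset.coe_range, mem_Iio, mem_ofPred_eq]
  constructor
  · refine fun h => ⟨fun k hk => ?_, fun k hk => ?_⟩
    · have := h k hk
      split_ifs at this
      · rw [this]
      · exact this
    · have := h k (by omega)
      rw [if_pos hk] at this
      rw [this]
  · rintro ⟨h1, h2⟩ k hk
    split_ifs with h
    · exact Subtype.ext (Prod.ext (h1 k hk) (h2 k h))
    · exact h1 k hk

/-- Squares of the same level are equal or disjoint. -/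
theorem symbSquare_disjoint (hm : 2 ≤ m) (hmn : m < n) {N : ℕ} {ω τ : ℕ → D}
    (h : τ ∉ symbSquare N ω) : Disjoint (symbSquare N ω) (symbSquare N τ) := by
  rw [Set.disjoint_left]
  intro ξ h1 h2
  rw [mem_symbSquare hm hmn] at h h1 h2
  exact h ⟨fun k hk => (h2.1 k hk).symm.trans (h1.1 k hk),
    fun k hk => (h2.2 k hk).symm.trans (h1.2 k hk)⟩

theorem measurableSet_symbSquare (N : ℕ) (ω : ℕ → D) : MeasurableSet (symbSquare N ω) :=
  MeasurableSet.pi (Finset.countable_toSet _) fun _ _ => MeasurableSet.of_discrete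

theorem codingMap_zero (ω : ℕ → D) : codingMap D ω 0 = digitValue fun k => (ω k).1.2 := rfl

theorem codingMap_one (ω : ℕ → D) : codingMap D ω 1 = digitValue fun k => (ω k).1.1 := rfl

theorem one_div_pow_colLevel_le (hm : 2 ≤ m) (hmn : m < n) (N : ℕ) :
    1 / (n : ℝ) ^ colLevel m n N ≤ 1 / (m : ℝ) ^ N := by
  have hm0 : (0 : ℝ) < m := by positivity
  have hn0 : (0 : ℝ) < n := by exact_mod_cast (by omega : 0 < n)
  have hn : 0 < Real.log n := Real.log_pos (by exact_mod_cast (by omega : 1 < n))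
  refine one_div_le_one_div_of_le (by positivity) ?_
  rw [← Real.log_le_log_iff (by positivity) (by positivity), Real.log_pow, Real.log_pow,
    ← sigma_mul_log hm hmn]
  nlinarith [le_colLevel (m := m) (n := n) N]

theorem le_one_div_pow_colLevel (hm : 2 ≤ m) (hmn : m < n) (N l : ℕ) :
    1 / ((m : ℝ) ^ N * (n : ℝ) ^ (l + 1)) ≤ 1 / (n : ℝ) ^ (colLevel m n N + l) := by
  have hm0 : (0 : ℝ) < m := by positivity
  have hn0 : (0 : ℝ) < n := by exact_mod_cast (by omega : 0 < n)
  have hn : 0 < Real.log n := Real.log_pos (by exact_mod_cast (by omega : 1 < n))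
  refine one_div_le_one_div_of_le (by positivity) ?_
  rw [← Real.log_le_log_iff (by positivity) (by positivity), Real.log_mul (by positivity)
    (by positivity), Real.log_pow, Real.log_pow, Real.log_pow, ← sigma_mul_log hm hmn]
  push_cast
  nlinarith [colLevel_lt hm hmn N]

/-- Points of an approximate square of level `N` are at distance at most `2 m ^ -N`. -/
theorem dist_le_of_mem_symbSquare (hm : 2 ≤ m) (hmn : m < n) {N : ℕ} {ω τ : ℕ → D}
    (h : τ ∈ symbSquare N ω) : dist (codingMap D τ) (codingMap D ω) ≤ 2 / (m : ℝ) ^ N := by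
  rw [mem_symbSquare hm hmn] at h
  have h0 := (abs_digitValue_sub_le (by omega) _ _ _ h.2).trans (one_div_pow_colLevel_le hm hmn N)
  have h1 := abs_digitValue_sub_le hm _ _ _ h.1
  have hm0 : (0 : ℝ) < m := by positivity
  rw [EuclideanSpace.dist_eq, Fin.sum_univ_two, codingMap_zero, codingMap_zero, codingMap_one,
    codingMap_one, Real.dist_eq, Real.dist_eq]
  refine Real.sqrt_le_iff.2 ⟨by positivity, ?_⟩
  have h2 : (0 : ℝ) < 1 / (m : ℝ) ^ N := by positivity
  have h3 : (2 : ℝ) / (m : ℝ) ^ N = 2 * (1 / (m : ℝ) ^ N) := by ring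
  rw [h3]
  nlinarith [pow_le_pow_left₀ (abs_nonneg _) h0 2, pow_le_pow_left₀ (abs_nonneg _) h1 2]

/-- Either the symbols `f (ω k)` are not all equal for `a ≤ k < a + l`, or `f` is constant on the
alphabet, in which case no two sequences can differ in these symbols. -/
def NoRun {β : Type*} (f : D → β) (a l : ℕ) (ω : ℕ → D) : Prop :=
  (∃ k ∈ Ico a (a + l), ∃ k' ∈ Ico a (a + l), f (ω k) ≠ f (ω k')) ∨ ∀ d d', f d = f d'

/-- The point coded by `ω` is far from the sides of its approximate square of level `N`, compared
with the scale `m ^ -N * n ^ -l`: after the last prescribed places there are no runs of length `l`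
of the same row, nor of the same column. -/
def Spread (N l : ℕ) (ω : ℕ → D) : Prop :=
  NoRun (fun d : D => d.1.1) N l ω ∧ NoRun (fun d : D => d.1.2) (colLevel m n N) l ω

theorem mem_symbSquare_of_dist_lt (hm : 2 ≤ m) (hmn : m < n) {N l : ℕ} {ω τ : ℕ → D}
    (hω : Spread N l ω)
    (h : dist (codingMap D τ) (codingMap D ω) < 1 / ((m : ℝ) ^ N * (n : ℝ) ^ (l + 1))) :
    τ ∈ symbSquare N ω := by
  have hm0 : (0 : ℝ) < m := by positivity
  have hn0 : (0 : ℝ) < n := by exact_mod_cast (by omega : 0 < n)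
  have hn1 : (1 : ℝ) ≤ n := by exact_mod_cast (by omega : 1 ≤ n)
  have hcoord : ∀ i, |codingMap D ω i - codingMap D τ i| ≤ dist (codingMap D τ) (codingMap D ω) :=
    fun i => by
      rw [dist_comm, dist_eq_norm, ← Real.norm_eq_abs]
      exact PiLp.norm_apply_le (codingMap D ω - codingMap D τ) i
  rw [mem_symbSquare hm hmn]
  constructor
  · rcases hω.1 with hr | hr
    · by_contra! hne
      obtain ⟨k, hk, hne⟩ := hne
      have := le_abs_digitValue_sub hm N l (fun k => (ω k).1.1) (fun k => (τ k).1.1) hr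
        ⟨k, hk, hne.symm⟩
      have h1 := hcoord 1
      rw [codingMap_one, codingMap_one] at h1
      refine absurd (this.trans (h1.trans h.le)) ?_
      have h2 : 1 / ((m : ℝ) ^ N * (n : ℝ) ^ (l + 1)) ≤ 1 / (m : ℝ) ^ (N + l) := by
        refine one_div_le_one_div_of_le (by positivity) ?_
        rw [pow_add]
        gcongr ?_ * ?_
        exact (pow_le_pow_left₀ hm0.le (by exact_mod_cast hmn.le) l).trans
          (pow_le_pow_right₀ hn1 l.le_succ)
      linarith
    · exact fun k _ => hr _ _
  · rcases hω.2 with hr | hr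
    · by_contra! hne
      obtain ⟨k, hk, hne⟩ := hne
      have := le_abs_digitValue_sub (by omega) (colLevel m n N) l (fun k => (ω k).1.2)
        (fun k => (τ k).1.2) hr ⟨k, hk, hne.symm⟩
      have h1 := hcoord 0
      rw [codingMap_zero, codingMap_zero] at h1
      linarith [le_one_div_pow_colLevel hm hmn N l]
    · exact fun k _ => hr _ _

end Squares

/-! ### Bounds for the packing dimension -/

section PackingBounds

variable {E : Type*} [MetricSpace E]

theorem packingPre_mono (s : ℝ≥0) {A B : Set E} (h : A ⊆ B) : packingPre s A ≤ packingPre s B :=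
  iInf₂_mono fun _ _ => iSup₂_mono fun _ _ => iSup_mono' fun hC =>
    ⟨⟨hC.countable, hC.subset.trans h, hC.pos, hC.lt, hC.separated⟩, le_rfl⟩

theorem packingMeasure_mono (s : ℝ≥0) {A B : Set E} (h : A ⊆ B) :
    packingMeasure s A ≤ packingMeasure s B :=
  iInf_mono fun _ => iInf_mono' fun hF => ⟨h.trans hF, le_rfl⟩

theorem dimP_mono {A B : Set E} (h : A ⊆ B) : dimP A ≤ dimP B :=
  iInf_mono fun s => iInf_mono' fun hB =>
    ⟨le_antisymm ((packingMeasure_mono s h).trans hB.le) zero_le, le_rfl⟩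

/-- A set has zero packing premeasure if, for all large `N`, its `2 b ^ -N`-separated subsets have
at most `g N` elements, where `g` grows more slowly than `b ^ (N s)`. -/
theorem packingPre_eq_zero_of_separated {s : ℝ≥0} {A : Set E} {b : ℝ} (hb : 1 < b) (g : ℕ → ℝ≥0∞)
    (N₀ : ℕ) (hg : ∀ N ≥ N₀, ∀ C ⊆ A, (C.Pairwise fun x y => 2 / b ^ N < dist x y) →
      ∑' _ : C, (1 : ℝ≥0∞) ≤ g N)
    (hsum : ∑' N, g N * ENNReal.ofReal (2 * b / b ^ N) ^ (s : ℝ) ≠ ∞) : packingPre s A = 0 := by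
  have hb0 : 0 < b := by linarith
  set h : ℕ → ℝ≥0∞ := fun N => ENNReal.ofReal (2 * b / b ^ N) ^ (s : ℝ) with hh
  have hlim := ENNReal.tendsto_sum_nat_add _ hsum
  refine le_antisymm (ge_of_tendsto hlim ?_) zero_le
  filter_upwards [eventually_ge_atTop N₀] with M hM
  refine iInf₂_le_of_le (1 / b ^ M) (by positivity) (iSup₂_le fun C r => iSup_le fun hC => ?_)
  have hlev : ∀ x : C, ∃ k, 1 / b ^ (k + M) < r x ∧ r x ≤ b / b ^ (k + M) := by
    rintro ⟨x, hx⟩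
    have h1 := hC.pos x hx
    have h2 := hC.lt x hx
    have h3 : 1 / b ^ M ≤ 1 := by
      rw [div_le_one (by positivity)]
      exact one_le_pow₀ hb.le
    obtain ⟨i, hi, hi'⟩ := exists_nat_pow_near_of_lt_one (x := r x) (y := 1 / b) h1
      (h2.le.trans h3) (by positivity) (by rw [div_lt_one hb0]; exact hb)
    have h4 : M ≤ i + 1 := by
      by_contra! hlt
      have : 1 / b ^ M ≤ (1 / b) ^ (i + 1) := by
        rw [← one_div_pow]
        refine pow_le_pow_of_le_one (by positivity) (by rw [div_le_one hb0]; exact hb.le) hlt.le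
      linarith
    refine ⟨i + 1 - M, ?_, ?_⟩
    · rw [Nat.sub_add_cancel h4, ← one_div_pow]
      exact hi
    · rw [Nat.sub_add_cancel h4, pow_succ, ← div_div, div_right_comm, div_self hb0.ne',
        ← one_div_pow]
      exact hi'
  choose lev hlev1 hlev2 using hlev
  -- Balls of comparable radii have centres separated at the scale of the radii, so `g` counts them.
  calc ∑' x : C, ENNReal.ofReal (2 * r x) ^ (s : ℝ)
      ≤ ∑' (x : C) (k : ℕ), if lev x = k then h (k + M) else 0 := by
        refine ENNReal.tsum_le_tsum fun x => ?_
        rw [tsum_ite_eq' (lev x)]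
        refine ENNReal.rpow_le_rpow (ENNReal.ofReal_le_ofReal ?_) s.2
        rw [mul_div_assoc]
        gcongr
        exact hlev2 x
    _ = ∑' (k : ℕ) (x : C), if lev x = k then h (k + M) else 0 := ENNReal.tsum_comm
    _ ≤ ∑' k : ℕ, g (k + M) * h (k + M) := by
        refine ENNReal.tsum_le_tsum fun k => ?_
        have h1 : ∑' x : C, (if lev x = k then h (k + M) else 0) =
            (∑' x : C, if lev x = k then 1 else 0) * h (k + M) := by
          rw [← ENNReal.tsum_mul_right]
          exact tsum_congr fun x => by split_ifs <;> simp
        have h2 : ∑' x : C, (if lev x = k then (1 : ℝ≥0∞) else 0) =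
            ∑' _ : ((↑) '' {x : C | lev x = k} : Set E), (1 : ℝ≥0∞) := by
          rw [tsum_image (fun _ => (1 : ℝ≥0∞)) Subtype.val_injective.injOn,
            tsum_subtype {x : C | lev x = k} fun _ => (1 : ℝ≥0∞)]
          exact tsum_congr fun x => by simp [Set.indicator]
        rw [h1, h2]
        gcongr
        refine hg _ (by omega) _ ?_ ?_
        · rintro _ ⟨x, _, rfl⟩
          exact hC.subset x.2
        · rintro _ ⟨x, hx, rfl⟩ _ ⟨y, hy, rfl⟩ hxy
          have h3 := hC.separated x.2 y.2 hxy
          have h4 := hlev1 x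
          have h5 := hlev1 y
          rw [hx] at h4
          rw [hy] at h5
          have h6 : 2 / b ^ (k + M) = 1 / b ^ (k + M) + 1 / b ^ (k + M) := by ring
          linarith

/-- The mass distribution principle for packing measures: `ν` is dominated by the packing measure
on a set at whose points `ν (B(x, 5r)) ≤ r ^ s` holds for arbitrarily small `r`. -/
theorem measure_le_packingMeasure {E : Type*} [NormedAddCommGroup E] [NormedSpace ℝ E]
    [SecondCountableTopology E] [MeasurableSpace E] (ν : Measure E) {s : ℝ≥0} {A : Set E}
    (h : ∀ x ∈ A, ∀ ρ > 0, ∃ r, 0 < r ∧ r < ρ ∧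
      ν (Metric.closedBall x (5 * r)) ≤ ENNReal.ofReal r ^ (s : ℝ)) :
    ν A ≤ packingMeasure s A := by
  have key : ∀ B ⊆ A, ν B ≤ packingPre s B := by
    intro B hB
    refine le_iInf₂ fun ε hε => ?_
    choose! r hr0 hr1 hr2 using fun x (hx : x ∈ B) => h x (hB hx) ε hε
    obtain ⟨u, huB, hdisj, hcov⟩ := Vitali.exists_disjoint_subfamily_covering_enlargement_closedBall
      B (fun x => x) r ε (fun x hx => (hr1 x hx).le) 5 (by norm_num)
    have hcount : u.Countable := hdisj.countable_of_nonempty_interior fun x hx =>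
      ⟨x, Metric.ball_subset_interior_closedBall (Metric.mem_ball_self (hr0 x (huB hx)))⟩
    have hpack : IsPacking B ε u r :=
      ⟨hcount, huB, fun x hx => hr0 x (huB hx), fun x hx => hr1 x (huB hx), fun x hx y hy hxy =>
        (disjoint_closedBall_closedBall_iff (hr0 x (huB hx)).le (hr0 y (huB hy)).le).1
          (hdisj hx hy hxy)⟩
    refine le_iSup_of_le u (le_iSup_of_le r (le_iSup_of_le hpack ?_))
    calc ν B ≤ ν (⋃ x ∈ u, Metric.closedBall x (5 * r x)) := by
          refine measure_mono fun x hx => ?_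
          obtain ⟨y, hy, hxy⟩ := hcov x hx
          exact mem_biUnion hy (hxy (Metric.mem_closedBall_self (hr0 x hx).le))
      _ ≤ ∑' x : u, ν (Metric.closedBall (x : E) (5 * r x)) := measure_biUnion_le ν hcount _
      _ ≤ ∑' x : u, ENNReal.ofReal (2 * r x) ^ (s : ℝ) := by
          refine ENNReal.tsum_le_tsum fun x => (hr2 x (huB x.2)).trans ?_
          exact ENNReal.rpow_le_rpow (ENNReal.ofReal_le_ofReal
            (by linarith [hr0 x (huB x.2)])) s.2
  refine le_iInf₂ fun F hF => ?_
  calc ν A ≤ ν (⋃ i, A ∩ F i) := by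
        refine measure_mono fun x hx => ?_
        obtain ⟨i, hi⟩ := mem_iUnion.1 (hF hx)
        exact mem_iUnion.2 ⟨i, hx, hi⟩
    _ ≤ ∑' i, ν (A ∩ F i) := measure_iUnion_le _
    _ ≤ ∑' i, packingPre s (F i) := ENNReal.tsum_le_tsum fun i =>
        (key _ inter_subset_left).trans (packingPre_mono s inter_subset_right)

theorem dimP_le_ofReal {A : Set E} {t : ℝ}
    (h : ∀ s : ℝ≥0, t < s → packingMeasure s A = 0) : dimP A ≤ ENNReal.ofReal t := by
  refine ENNReal.le_of_forall_pos_le_add fun ε hε _ => ?_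
  have h1 : t < (t.toNNReal + ε : ℝ≥0) := by
    push_cast
    linarith [Real.le_coe_toNNReal t, NNReal.coe_pos.2 hε]
  refine (iInf₂_le (t.toNNReal + ε) (h _ h1)).trans ?_
  push_cast
  rfl

theorem ofReal_le_dimP {A : Set E} {t : ℝ}
    (h : ∀ s : ℝ≥0, (s : ℝ) < t → packingMeasure s A ≠ 0) : ENNReal.ofReal t ≤ dimP A := by
  refine le_iInf₂ fun s hs => ?_
  have : t ≤ s := not_lt.1 fun hlt => h s hlt hs
  exact ENNReal.ofReal_le_of_le_toReal (by simpa using this)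

end PackingBounds

/-! ### Product measures on the symbolic space -/

section Products

variable {m n : ℕ} {D : Finset (Fin m × Fin n)}

/-- The law of independent digits, the `k`-th one with distribution `w k`. -/
noncomputable def productMeasure (w : ℕ → PMF D) : Measure (ℕ → D) :=
  Measure.infinitePi fun k => (w k).toMeasure

instance isProbabilityMeasure_productMeasure (w : ℕ → PMF D) :
    IsProbabilityMeasure (productMeasure w) := by
  unfold productMeasure; infer_instance

theorem productMeasure_real_pi (w : ℕ → PMF D) (s : Finset ℕ) (t : ℕ → Set D) :
    (productMeasure w).real ((s : Set ℕ).pi t) = ∏ k ∈ s, (w k).toMeasure.real (t k) := by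
  rw [measureReal_def, productMeasure, Measure.infinitePi_pi _ fun _ _ => MeasurableSet.of_discrete,
    ENNReal.toReal_prod]
  rfl

theorem sum_row (D : Finset (Fin m × Fin n)) (g : Fin m → ℝ) :
    ∑ d : D, g d.1.1 = ∑ i ∈ rows D, (rowCount D i : ℝ) * g i := by
  rw [Finset.sum_coe_sort D fun d => g d.1, Finset.sum_comp g Prod.fst]
  exact Finset.sum_congr rfl fun i _ => by rw [nsmul_eq_mul]; rfl

theorem rowCount_pos (d : D) : 0 < rowCount D d.1.1 :=
  Finset.card_pos.2 ⟨d.1, Finset.mem_filter.2 ⟨d.2, rfl⟩⟩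

theorem rowCount_pos_of_mem {i : Fin m} (hi : i ∈ rows D) : 0 < rowCount D i := by
  obtain ⟨d, hd, rfl⟩ := Finset.mem_image.1 hi
  exact rowCount_pos ⟨d, hd⟩

theorem sum_div_rowCount (D : Finset (Fin m × Fin n)) (g : Fin m → ℝ) :
    ∑ d : D, 1 / ((rowCount D d.1.1 : ℝ) * ((rows D).card : ℝ)) * g d.1.1 =
      ∑ i ∈ rows D, 1 / ((rows D).card : ℝ) * g i := by
  rw [sum_row D fun i => 1 / ((rowCount D i : ℝ) * ((rows D).card : ℝ)) * g i]
  refine Finset.sum_congr rfl fun i hi => ?_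
  have : (rowCount D i : ℝ) ≠ 0 := by exact_mod_cast (rowCount_pos_of_mem hi).ne'
  rw [← mul_assoc, one_div, mul_inv, ← mul_assoc, mul_inv_cancel₀ this, one_mul, one_div]

theorem card_rows_le : (rows D).card ≤ D.card := Finset.card_image_le

theorem pmf_real_eq_sum (u : PMF D) (s : Set D) [DecidablePred (· ∈ s)] :
    u.toMeasure.real s = ∑ d : D, if d ∈ s then (u d).toReal else 0 := by
  rw [measureReal_def, PMF.toMeasure_apply_fintype, ENNReal.toReal_sum
    fun d _ => by by_cases h : d ∈ s <;> simp [h, PMF.apply_ne_top]]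
  refine Finset.sum_congr rfl fun d _ => ?_
  by_cases h : d ∈ s <;> simp [h]

theorem pmf_real_singleton (u : PMF D) (d : D) : u.toMeasure.real {d} = (u d).toReal := by
  rw [measureReal_def, PMF.toMeasure_apply_singleton _ _ (measurableSet_singleton d)]

theorem pmf_real_row (u : PMF D) (i : Fin m) :
    u.toMeasure.real {d : D | d.1.1 = i} = rowProb u i := by
  rw [pmf_real_eq_sum]
  rfl

theorem toMeasure_cell_of_lt (u : PMF D) {N k : ℕ} (ω : ℕ → D) (hk : k < colLevel m n N) :
    u.toMeasure.real (cell N ω k) = (u (ω k)).toReal := by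
  rw [← pmf_real_singleton]
  congr 1
  ext d
  simp [cell, hk]

theorem toMeasure_cell_of_le (u : PMF D) {N k : ℕ} (ω : ℕ → D) (hk : colLevel m n N ≤ k) :
    u.toMeasure.real (cell N ω k) = rowProb u (ω k).1.1 := by
  rw [← pmf_real_row]
  congr 1
  ext d
  simp [cell, hk.not_gt]

variable [Nonempty D]

theorem card_pos_of_nonempty : 0 < D.card :=
  Finset.card_pos.2 ⟨_, (Classical.arbitrary D).2⟩

theorem card_rows_pos : 0 < (rows D).card :=
  Finset.card_pos.2 ⟨_, Finset.mem_image_of_mem _ (Classical.arbitrary D).2⟩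

variable (D) in
/-- The distribution of a digit whose row is uniformly distributed among the non-empty rows, and
which is uniformly distributed in its row. -/
noncomputable def rowUniform : PMF D :=
  PMF.ofFintype
    (fun d => ENNReal.ofReal (1 / ((rowCount D d.1.1 : ℝ) * ((rows D).card : ℝ)))) (by
      have h := sum_div_rowCount D fun _ => 1
      have h0 : ((rows D).card : ℝ) ≠ 0 := by exact_mod_cast card_rows_pos.ne'
      simp only [mul_one, Finset.sum_const, nsmul_eq_mul, mul_one_div_cancel h0] at h
      rw [← ENNReal.ofReal_sum_of_nonneg fun _ _ => by positivity, h, ENNReal.ofReal_one])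

theorem rowUniform_apply_toReal (d : D) :
    (rowUniform D d).toReal = 1 / ((rowCount D d.1.1 : ℝ) * ((rows D).card : ℝ)) := by
  rw [rowUniform, PMF.ofFintype_apply, ENNReal.toReal_ofReal (by positivity)]

theorem uniform_apply_toReal (d : D) :
    (PMF.uniformOfFintype D d).toReal = 1 / (D.card : ℝ) := by
  simp

theorem rowProb_rowUniform {i : Fin m} (hi : i ∈ rows D) :
    rowProb (rowUniform D) i = 1 / ((rows D).card : ℝ) := by
  have h := sum_div_rowCount D fun j => if j = i then 1 else 0
  rw [Finset.sum_eq_single_of_mem i hi fun j _ hj => by simp [hj]] at h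
  simp only [if_true, mul_one] at h
  rw [← h, rowProb]
  refine Finset.sum_congr rfl fun d _ => ?_
  rw [rowUniform_apply_toReal]
  split_ifs <;> simp

open Classical in
variable (D) in
/-- Uniform digits at the places in `S`, digits with uniform rows at the other places. -/
noncomputable def mixture (S : Set ℕ) (k : ℕ) : PMF D :=
  if k ∈ S then PMF.uniformOfFintype D else rowUniform D

theorem mixture_of_mem {S : Set ℕ} {k : ℕ} (h : k ∈ S) :
    mixture D S k = PMF.uniformOfFintype D := if_pos h

theorem mixture_of_notMem {S : Set ℕ} {k : ℕ} (h : k ∉ S) :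
    mixture D S k = rowUniform D := if_neg h

theorem le_mixture (S : Set ℕ) (k : ℕ) (d : D) :
    1 / ((D.card : ℝ) * D.card) ≤ (mixture D S k d).toReal := by
  have h0 : (0 : ℝ) < rowCount D d.1.1 := by exact_mod_cast rowCount_pos d
  have h1 : (0 : ℝ) < (rows D).card := by exact_mod_cast card_rows_pos
  have h2 : (1 : ℝ) ≤ D.card := by exact_mod_cast card_pos_of_nonempty
  have h3 : ((rows D).card : ℝ) ≤ D.card := by exact_mod_cast card_rows_le
  have h4 : (rowCount D d.1.1 : ℝ) ≤ D.card := by exact_mod_cast Finset.card_filter_le _ _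
  by_cases h : k ∈ S
  · rw [mixture_of_mem h, uniform_apply_toReal]
    exact one_div_le_one_div_of_le (by linarith) (by nlinarith)
  · rw [mixture_of_notMem h, rowUniform_apply_toReal]
    exact one_div_le_one_div_of_le (by positivity) (by gcongr)

variable (D) in
/-- The inverse of the number of words that define approximate squares of level `N`. -/
noncomputable def squareMass (N : ℕ) : ℝ :=
  (1 / (D.card : ℝ)) ^ colLevel m n N * (1 / ((rows D).card : ℝ)) ^ (N - colLevel m n N)

theorem squareMass_pos (N : ℕ) : 0 < squareMass D N := by
  have h1 : (0 : ℝ) < (rows D).card := by exact_mod_cast card_rows_pos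
  have h2 : (0 : ℝ) < D.card := by exact_mod_cast card_pos_of_nonempty
  unfold squareMass
  positivity

theorem prod_ite_lt {c N : ℕ} (h : c ≤ N) (x y : ℝ) :
    ∏ k ∈ Finset.range N, (if k < c then x else y) = x ^ c * y ^ (N - c) := by
  obtain ⟨j, rfl⟩ := Nat.exists_eq_add_of_le h
  rw [Finset.prod_range_add, Nat.add_sub_cancel_left]
  congr 1
  · rw [Finset.prod_congr rfl fun k hk => if_pos (Finset.mem_range.1 hk)]
    simp
  · simp

theorem mixture_cell {S : Set ℕ} {N k : ℕ} (ω : ℕ → D)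
    (h1 : k < colLevel m n N → k ∈ S) (h2 : colLevel m n N ≤ k → k ∉ S) :
    (mixture D S k).toMeasure.real (cell N ω k) =
      if k < colLevel m n N then 1 / (D.card : ℝ) else 1 / ((rows D).card : ℝ) := by
  split_ifs with hk
  · rw [toMeasure_cell_of_lt _ _ hk, mixture_of_mem (h1 hk), uniform_apply_toReal]
  · rw [toMeasure_cell_of_le _ _ (not_lt.1 hk), mixture_of_notMem (h2 (not_lt.1 hk)),
      rowProb_rowUniform (Finset.mem_image_of_mem _ (ω k).2)]

theorem mixture_symbSquare (hm : 2 ≤ m) (hmn : m < n) (N : ℕ) (ω : ℕ → D) :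
    (productMeasure (mixture D (Iio (colLevel m n N)))).real (symbSquare N ω) =
      squareMass D N := by
  rw [symbSquare, productMeasure_real_pi, squareMass, ← prod_ite_lt (colLevel_le hm hmn N)]
  exact Finset.prod_congr rfl fun k _ => mixture_cell ω (fun h => h) fun h => not_lt.2 h

theorem mixture_symbSquare_le (hm : 2 ≤ m) (hmn : m < n) {S : Set ℕ} {a N : ℕ} (ha : a ≤ N)
    (ω : ℕ → D) (h1 : ∀ k, a ≤ k → k < colLevel m n N → k ∈ S)
    (h2 : ∀ k, a ≤ k → k < N → colLevel m n N ≤ k → k ∉ S) :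
    (productMeasure (mixture D S)).real (symbSquare N ω) ≤ (D.card : ℝ) ^ a * squareMass D N := by
  have hL1 : (1 : ℝ) ≤ (rows D).card := by exact_mod_cast card_rows_pos
  have hL0 : (1 : ℝ) ≤ D.card := by exact_mod_cast card_pos_of_nonempty
  have h3 : ((rows D).card : ℝ) ≤ D.card := by exact_mod_cast card_rows_le
  rw [symbSquare, productMeasure_real_pi, squareMass, ← prod_ite_lt (colLevel_le hm hmn N),
    show (D.card : ℝ) ^ a = (D.card : ℝ) ^ a * 1 ^ (N - a) by simp, ← prod_ite_lt ha,
    ← Finset.prod_mul_distrib]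
  refine Finset.prod_le_prod (fun _ _ => measureReal_nonneg) fun k hk => ?_
  by_cases hka : k < a
  · rw [if_pos hka]
    refine measureReal_le_one.trans ?_
    split_ifs
    · rw [mul_one_div_cancel (by linarith)]
    · rw [mul_one_div, le_div_iff₀ (by linarith), one_mul]
      exact h3
  · rw [if_neg hka, one_mul, mixture_cell ω (h1 k (not_lt.1 hka))
      (h2 k (not_lt.1 hka) (Finset.mem_range.1 hk))]

variable (D) in
/-- The box dimension of the carpet, multiplied by `log m`: the exponential growth rate of the
number of approximate squares of level `N`. -/
noncomputable def squareEntropy : ℝ :=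
  sigma m n * Real.log D.card + (1 - sigma m n) * Real.log (rows D).card

theorem log_squareMass (N : ℕ) (hm : 2 ≤ m) (hmn : m < n) :
    Real.log (squareMass D N) =
      -(colLevel m n N * Real.log D.card + (N - colLevel m n N) * Real.log (rows D).card) := by
  have h1 : (0 : ℝ) < (rows D).card := by exact_mod_cast card_rows_pos
  have h2 : (0 : ℝ) < D.card := by exact_mod_cast card_pos_of_nonempty
  rw [squareMass, Real.log_mul (by positivity) (by positivity), Real.log_pow, Real.log_pow,
    one_div, one_div, Real.log_inv, Real.log_inv, Nat.cast_sub (colLevel_le hm hmn N)]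
  ring

theorem inv_squareMass_le (hm : 2 ≤ m) (hmn : m < n) (N : ℕ) :
    (squareMass D N)⁻¹ ≤ D.card * Real.exp (N * squareEntropy D) := by
  have hL1 : (1 : ℝ) ≤ (rows D).card := by exact_mod_cast card_rows_pos
  have hL0 : (1 : ℝ) ≤ D.card := by exact_mod_cast card_pos_of_nonempty
  have h0 := Real.log_nonneg hL0
  have h1 := Real.log_nonneg hL1
  rw [← Real.log_le_log_iff (inv_pos.2 (squareMass_pos N)) (by positivity), Real.log_inv,
    log_squareMass N hm hmn, Real.log_mul (by linarith) (Real.exp_ne_zero _), Real.log_exp,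
    squareEntropy]
  nlinarith [le_colLevel (m := m) (n := n) N, colLevel_lt hm hmn N]

theorem squareMass_le (hm : 2 ≤ m) (hmn : m < n) (N : ℕ) :
    squareMass D N ≤ (rows D).card * Real.exp (-(N * squareEntropy D)) := by
  have hL1 : (1 : ℝ) ≤ (rows D).card := by exact_mod_cast card_rows_pos
  have hL0 : (1 : ℝ) ≤ D.card := by exact_mod_cast card_pos_of_nonempty
  have h0 := Real.log_nonneg hL0
  have h1 := Real.log_nonneg hL1
  rw [← Real.log_le_log_iff (squareMass_pos N) (by positivity),
    log_squareMass N hm hmn, Real.log_mul (by linarith) (Real.exp_ne_zero _), Real.log_exp,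
    squareEntropy]
  nlinarith [le_colLevel (m := m) (n := n) N, colLevel_lt hm hmn N]

/-- A set of points whose codes lie, for all large `N`, in an exponentially small union of
approximate squares of level `N` has a smaller packing dimension than the carpet. -/
theorem dimP_le_of_eventually_mem (hm : 2 ≤ m) (hmn : m < n)
    {code : EuclideanSpace ℝ (Fin 2) → ℕ → D} (hcode : ∀ x ∈ carpet D, codingMap D (code x) = x)
    (Bad : ℕ → Set (ℕ → D)) (hsat : ∀ N, ∀ ω ∈ Bad N, symbSquare N ω ⊆ Bad N) {K c : ℝ}
    (hBad : ∀ N : ℕ, (productMeasure (mixture D (Iio (colLevel m n N)))).real (Bad N) ≤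
      K * Real.exp (-(c * N))) :
    dimP {x ∈ carpet D | ∀ᶠ N in atTop, code x ∈ Bad N} ≤
      ENNReal.ofReal ((squareEntropy D - c) / Real.log m) := by
  have hm1 : (1 : ℝ) < m := by exact_mod_cast hm
  have hm0 : (0 : ℝ) < m := by linarith
  have hlog : 0 < Real.log m := Real.log_pos hm1
  refine dimP_le_ofReal fun s hs => ?_
  rw [div_lt_iff₀ hlog] at hs
  have hpre : ∀ N₀, packingPre s {x ∈ carpet D | ∀ N ≥ N₀, code x ∈ Bad N} = 0 := by
    intro N₀
    refine packingPre_eq_zero_of_separated hm1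
      (fun N => ENNReal.ofReal (K * Real.exp (-(c * N)) * (squareMass D N)⁻¹)) N₀ ?_ ?_
    · intro N hN C hC hsep
      have hw := squareMass_pos (D := D) N
      set P := productMeasure (mixture D (Iio (colLevel m n N)))
      -- Separated points lie in different squares, all of which have the same mass for `P`.
      have hdisj : Pairwise (Function.onFun Disjoint fun x : C => symbSquare N (code x)) := by
        intro x y hxy
        refine symbSquare_disjoint hm hmn fun hmem => ?_
        have h1 := dist_le_of_mem_symbSquare hm hmn hmem
        rw [hcode _ (hC x.2).1, hcode _ (hC y.2).1, dist_comm] at h1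
        exact absurd (hsep x.2 y.2 fun h => hxy (Subtype.ext h)) (not_lt.2 h1)
      have h1 := tsum_meas_le_meas_iUnion_of_disjoint P
        (fun x : C => measurableSet_symbSquare N (code x)) hdisj
      have h2 : P (⋃ x : C, symbSquare N (code x)) ≤ ENNReal.ofReal (K * Real.exp (-(c * N))) :=
        (measure_mono (iUnion_subset fun x => hsat N _ ((hC x.2).2 N hN))).trans
          (ENNReal.le_ofReal_iff_toReal_le (measure_ne_top _ _)
            (measureReal_nonneg.trans (hBad N)) |>.2 (hBad N))
      have h3 : ∀ x : C, P (symbSquare N (code x)) = 1 * ENNReal.ofReal (squareMass D N) :=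
        fun x => by
          rw [← mixture_symbSquare hm hmn N (code x), ofReal_measureReal, one_mul]
      simp only [h3, ENNReal.tsum_mul_right] at h1
      rw [← div_eq_mul_inv, ENNReal.ofReal_div_of_pos hw, ENNReal.le_div_iff_mul_le
        (Or.inl (by simpa using hw)) (Or.inl ENNReal.ofReal_ne_top)]
      exact h1.trans h2
    · have hK : 0 ≤ K := by
        have := measureReal_nonneg.trans (hBad 0)
        simpa using this
      set θ : ℝ := Real.exp (squareEntropy D - c - s * Real.log m) with hθ
      have hθ1 : θ < 1 := by rw [hθ, Real.exp_lt_one_iff]; linarith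
      have hsum : Summable fun N : ℕ => K * D.card * (2 * m : ℝ) ^ (s : ℝ) * θ ^ N :=
        (summable_geometric_of_lt_one (Real.exp_pos _).le hθ1).mul_left _
      refine ne_top_of_le_ne_top hsum.tsum_ofReal_ne_top (ENNReal.tsum_le_tsum fun N => ?_)
      rw [ENNReal.ofReal_rpow_of_nonneg (by positivity) s.coe_nonneg, ← ENNReal.ofReal_mul
        (mul_nonneg (by positivity) (inv_nonneg.2 (squareMass_pos N).le))]
      refine ENNReal.ofReal_le_ofReal ?_
      have h1 : ((m : ℝ) ^ N) ^ (s : ℝ) = Real.exp (N * (s * Real.log m)) := by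
        rw [Real.rpow_def_of_pos (by positivity), Real.log_pow]
        ring_nf
      calc K * Real.exp (-(c * N)) * (squareMass D N)⁻¹ * (2 * m / (m : ℝ) ^ N) ^ (s : ℝ)
          ≤ K * Real.exp (-(c * N)) * (D.card * Real.exp (N * squareEntropy D)) *
              (2 * m / (m : ℝ) ^ N) ^ (s : ℝ) := by
            gcongr
            exact inv_squareMass_le hm hmn N
        _ = K * D.card * (2 * m : ℝ) ^ (s : ℝ) * θ ^ N := by
            rw [Real.div_rpow (by positivity) (by positivity), h1, hθ, ← Real.exp_nat_mul,
              div_eq_mul_inv, ← Real.exp_neg]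
            have : (N : ℝ) * (squareEntropy D - c - s * Real.log m) =
              -(c * N) + N * squareEntropy D + -(N * (s * Real.log m)) := by ring
            rw [this, Real.exp_add, Real.exp_add]
            ring
  refine le_antisymm (iInf₂_le_of_le (fun N₀ => {x ∈ carpet D | ∀ N ≥ N₀, code x ∈ Bad N}) ?_ ?_)
    zero_le
  · rintro x ⟨hx, hev⟩
    obtain ⟨N₀, hN₀⟩ := eventually_atTop.1 hev
    exact mem_iUnion.2 ⟨N₀, hx, hN₀⟩
  · simp [hpre]

theorem dimP_carpet_le (hm : 2 ≤ m) (hmn : m < n)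
    {code : EuclideanSpace ℝ (Fin 2) → ℕ → D} (hcode : ∀ x ∈ carpet D, codingMap D (code x) = x) :
    dimP (carpet D) ≤ ENNReal.ofReal (squareEntropy D / Real.log m) := by
  have h := dimP_le_of_eventually_mem hm hmn hcode (fun _ => univ) (fun _ _ _ => subset_univ _)
    (K := 1) (c := 0) (fun N => by simp)
  simpa using h

end Products

/-! ### Large deviations for independent digits -/

section Deviations

variable {m n : ℕ} {D : Finset (Fin m × Fin n)}

/-- If all digits have probability at least `δ` at all places, runs of length `l` have
exponentially small probability. -/
theorem productMeasure_not_noRun_le {β : Type*} [Nonempty D] {w : ℕ → PMF D} {δ : ℝ}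
    (hδ : ∀ k d, δ ≤ (w k d).toReal) (f : D → β) (a l : ℕ) :
    (productMeasure w).real {ω | ¬ NoRun f a l ω} ≤ D.card * Real.exp (-(δ * l)) := by
  by_cases hf : ∀ d d', f d = f d'
  · have : {ω : ℕ → D | ¬ NoRun f a l ω} = ∅ :=
      eq_empty_of_forall_notMem fun ω hω => hω (Or.inr hf)
    rw [this, measureReal_empty]
    positivity
  -- A run repeats the symbol of some digit `d`.
  have hcover : {ω : ℕ → D | ¬ NoRun f a l ω} ⊆
      ⋃ d : D, (Finset.Ico a (a + l) : Set ℕ).pi fun _ => {d' | f d' = f d} := by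
    intro ω hω
    simp only [NoRun, mem_ofPred_eq, not_or, not_exists, not_and, not_not] at hω
    refine mem_iUnion.2 ⟨ω a, fun k hk => ?_⟩
    rw [Finset.coe_Ico] at hk
    exact hω.1 k hk a ⟨le_rfl, hk.1.trans_lt hk.2⟩
  have hone : ∀ k d, (w k).toMeasure.real {d' | f d' = f d} ≤ Real.exp (-δ) := by
    intro k d
    obtain ⟨d', hd'⟩ : ∃ d', f d' ≠ f d := by
      by_contra! h
      exact hf fun x y => (h x).trans (h y).symm
    calc (w k).toMeasure.real {d' | f d' = f d} ≤ (w k).toMeasure.real {d'}ᶜ :=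
          measureReal_mono fun x hx hxd => hd' (hxd ▸ hx)
      _ = 1 - (w k d').toReal := by
          rw [probReal_compl_eq_one_sub (measurableSet_singleton d'), pmf_real_singleton]
      _ ≤ 1 - δ := by linarith [hδ k d']
      _ ≤ Real.exp (-δ) := Real.one_sub_le_exp_neg δ
  calc (productMeasure w).real {ω | ¬ NoRun f a l ω}
      ≤ (productMeasure w).real (⋃ d : D, (Finset.Ico a (a + l) : Set ℕ).pi
          fun _ => {d' | f d' = f d}) := measureReal_mono hcover
    _ ≤ ∑ d : D, (productMeasure w).real ((Finset.Ico a (a + l) : Set ℕ).pi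
          fun _ => {d' | f d' = f d}) := measureReal_iUnion_fintype_le _
    _ ≤ ∑ _ : D, Real.exp (-δ) ^ l := by
        refine Finset.sum_le_sum fun d _ => ?_
        rw [productMeasure_real_pi]
        refine (Finset.prod_le_prod (fun _ _ => measureReal_nonneg) fun k _ => hone k d).trans ?_
        simp
    _ = D.card * Real.exp (-(δ * l)) := by
        rw [Finset.sum_const, ← Real.exp_nat_mul]
        simp [mul_comm]

theorem productMeasure_not_spread_le [Nonempty D] {w : ℕ → PMF D} {δ : ℝ}
    (hδ : ∀ k d, δ ≤ (w k d).toReal) (N l : ℕ) :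
    (productMeasure w).real {ω | ¬ Spread N l ω} ≤ 2 * D.card * Real.exp (-(δ * l)) := by
  have hsub : {ω : ℕ → D | ¬ Spread N l ω} ⊆ {ω | ¬ NoRun (fun d : D => d.1.1) N l ω} ∪
      {ω | ¬ NoRun (fun d : D => d.1.2) (colLevel m n N) l ω} := fun ω hω => by
    rw [mem_ofPred_eq, Spread, not_and_or] at hω
    exact hω
  refine (measureReal_mono hsub).trans ((measureReal_union_le _ _).trans ?_)
  linarith [productMeasure_not_noRun_le hδ (fun d : D => d.1.1) N l,
    productMeasure_not_noRun_le hδ (fun d : D => d.1.2) (colLevel m n N) l]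

theorem ae_eventually_notMem_of_exp_bound {Ω : Type*} [MeasurableSpace Ω] {μ : Measure Ω}
    [IsFiniteMeasure μ] {s : ℕ → Set Ω} {K c : ℝ} (hc : 0 < c)
    (h : ∀ N : ℕ, μ.real (s N) ≤ K * Real.exp (-(c * N))) :
    ∀ᵐ ω ∂μ, ∀ᶠ N in atTop, ω ∉ s N := by
  refine ae_eventually_notMem (ne_top_of_le_ne_top (b := ∑' N : ℕ,
    ENNReal.ofReal (K * Real.exp (-c) ^ N)) ?_ (ENNReal.tsum_le_tsum fun N => ?_))
  · exact ((summable_geometric_of_lt_one (Real.exp_pos _).le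
      (Real.exp_lt_one_iff.2 (neg_lt_zero.2 hc))).mul_left K).tsum_ofReal_ne_top
  · rw [← ofReal_measureReal, ← Real.exp_nat_mul]
    refine ENNReal.ofReal_le_ofReal ((h N).trans_eq ?_)
    ring_nf

theorem ae_eventually_spread [Nonempty D] {w : ℕ → PMF D} {δ : ℝ} (hδ0 : 0 < δ)
    (hδ : ∀ k d, δ ≤ (w k d).toReal) {ε : ℝ} (hε : 0 < ε) :
    ∀ᵐ ω ∂productMeasure w, ∀ᶠ N : ℕ in atTop, Spread N ⌊ε * N⌋₊ ω := by
  have := ae_eventually_notMem_of_exp_bound (μ := productMeasure w)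
    (s := fun N => {ω : ℕ → D | ¬ Spread N ⌊ε * N⌋₊ ω})
    (K := 2 * D.card * Real.exp δ) (c := δ * ε) (by positivity) fun N => by
      refine (productMeasure_not_spread_le hδ N _).trans ?_
      rw [mul_assoc (2 * (D.card : ℝ)), ← Real.exp_add]
      gcongr
      nlinarith [Nat.lt_floor_add_one (ε * N)]
  filter_upwards [this] with ω hω
  filter_upwards [hω] with N hN
  simpa using hN

/-- Almost every point has only one code: the squares around a point that is infinitely often well
inside its squares determine the code. -/
theorem ae_code_unique [Nonempty D] (hm : 2 ≤ m) (hmn : m < n) {w : ℕ → PMF D} {δ : ℝ}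
    (hδ0 : 0 < δ) (hδ : ∀ k d, δ ≤ (w k d).toReal) :
    ∀ᵐ ω ∂productMeasure w, ∀ τ, codingMap D τ = codingMap D ω → τ = ω := by
  filter_upwards [ae_eventually_spread hδ0 hδ one_pos] with ω hω τ hτ
  funext k
  obtain ⟨N, h1, h2, h3⟩ := (hω.and (((tendsto_colLevel hm hmn).eventually_gt_atTop k).and
    (eventually_gt_atTop k))).exists
  have hmem : τ ∈ symbSquare N ω := mem_symbSquare_of_dist_lt hm hmn h1 (by
    have hm0 : (0 : ℝ) < m := by positivity
    have hn0 : (0 : ℝ) < n := by exact_mod_cast (by omega : 0 < n)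
    rw [hτ, dist_self]
    positivity)
  rw [mem_symbSquare hm hmn] at hmem
  exact Subtype.ext (Prod.ext (hmem.1 k h3) (hmem.2 k h2))

theorem productMeasure_sum_ge_le (w : ℕ → PMF D) {f : ℕ → D → ℝ} {C : ℝ}
    (hf : ∀ k d, |f k d| ≤ C) (K : ℕ) {t : ℝ} (ht : 0 ≤ t) :
    (productMeasure w).real {ω | t ≤ ∑ k ∈ Finset.range K,
      (f k (ω k) - ∑ d, (w k d).toReal * f k d)} ≤ Real.exp (-t ^ 2 / (2 * K * C ^ 2)) := by
  have hmean : ∀ k, ∫ ω, f k (ω k) ∂productMeasure w = ∑ d, (w k d).toReal * f k d := by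
    intro k
    have hmp := measurePreserving_eval_infinitePi (fun k => (w k).toMeasure) k
    rw [show (∫ ω, f k (ω k) ∂productMeasure w) = ∫ d, f k d ∂(w k).toMeasure by
      rw [← hmp.map_eq, integral_map hmp.measurable.aemeasurable
        (Measurable.of_discrete (f := f k)).aestronglyMeasurable]
      rfl, PMF.integral_eq_sum]
    simp only [smul_eq_mul]
  have hind : ProbabilityTheory.iIndepFun
      (fun k (ω : ℕ → D) => f k (ω k) - ∑ d, (w k d).toReal * f k d) (productMeasure w) :=
    ProbabilityTheory.iIndepFun_infinitePi (P := fun k => (w k).toMeasure)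
      (X := fun k d => f k d - ∑ d, (w k d).toReal * f k d) fun _ => Measurable.of_discrete
  have hsub : ∀ k < K, ProbabilityTheory.HasSubgaussianMGF
      (fun ω : ℕ → D => f k (ω k) - ∑ d, (w k d).toReal * f k d) (‖C‖₊ ^ 2)
        (productMeasure w) := by
    intro k _
    have h := ProbabilityTheory.hasSubgaussianMGF_of_mem_Icc (μ := productMeasure w)
      (X := fun ω => f k (ω k)) (a := -C) (b := C)
      ((Measurable.of_discrete (f := f k)).comp (measurable_pi_apply k)).aemeasurable
      (ae_of_all _ fun ω => abs_le.1 (hf k (ω k)))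
    rw [hmean] at h
    convert h using 1
    rw [sub_neg_eq_add, ← two_mul, nnnorm_mul]
    simp
  refine (ProbabilityTheory.HasSubgaussianMGF.measure_sum_range_ge_le_of_iIndepFun hind hsub
    ht).trans_eq ?_
  simp

/-- Hoeffding's inequality: a sum of at most `M` bounded functions of the digits deviates from
its mean by `η M` with an exponentially small probability. -/
theorem productMeasure_abs_sum_sub_ge_le (w : ℕ → PMF D) {f : ℕ → D → ℝ} {C : ℝ} (hC : 0 < C)
    (hf : ∀ k d, |f k d| ≤ C) {K M : ℕ} (hKM : K ≤ M) {η : ℝ} (hη : 0 < η) :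
    (productMeasure w).real {ω | η * M ≤ |∑ k ∈ Finset.range K, f k (ω k) -
      ∑ k ∈ Finset.range K, ∑ d, (w k d).toReal * f k d|} ≤
      2 * Real.exp (-(η ^ 2 / (2 * C ^ 2) * M)) := by
  rcases Nat.eq_zero_or_pos K with rfl | hK
  · rcases Nat.eq_zero_or_pos M with rfl | hM
    · refine measureReal_le_one.trans ?_
      simp
    · have hM' : (0 : ℝ) < M := by exact_mod_cast hM
      have : ¬ η * M ≤ 0 := not_le.2 (by positivity)
      simp only [Finset.range_zero, Finset.sum_empty, sub_self, abs_zero, this]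
      simp only [ofPred_false, measureReal_empty]
      positivity
  · have hK' : (0 : ℝ) < K := by exact_mod_cast hK
    have hKM' : (K : ℝ) ≤ M := by exact_mod_cast hKM
    have ht : 0 ≤ η * M := by positivity
    have h1 := productMeasure_sum_ge_le w hf K ht
    have h2 := productMeasure_sum_ge_le w (f := fun k d => -f k d) (C := C)
      (fun k d => by rw [abs_neg]; exact hf k d) K ht
    have hexp : Real.exp (-(η * M) ^ 2 / (2 * K * C ^ 2)) ≤
        Real.exp (-(η ^ 2 / (2 * C ^ 2) * M)) := by
      rw [Real.exp_le_exp, neg_div, neg_le_neg_iff, div_mul_eq_mul_div,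
        div_le_div_iff₀ (by positivity) (by positivity)]
      have : 0 ≤ η ^ 2 * M * (2 * C ^ 2) * (M - K) :=
        mul_nonneg (by positivity) (sub_nonneg.2 hKM')
      linarith
    have hsub : {ω : ℕ → D | η * M ≤ |∑ k ∈ Finset.range K, f k (ω k) -
        ∑ k ∈ Finset.range K, ∑ d, (w k d).toReal * f k d|} ⊆
        {ω | η * M ≤ ∑ k ∈ Finset.range K, (f k (ω k) - ∑ d, (w k d).toReal * f k d)} ∪
        {ω | η * M ≤ ∑ k ∈ Finset.range K, (-f k (ω k) - ∑ d, (w k d).toReal * -f k d)} := by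
      intro ω hω
      rw [mem_ofPred_eq, le_abs] at hω
      refine hω.imp (fun h => ?_) fun h => ?_
      · rw [mem_ofPred_eq, Finset.sum_sub_distrib]
        exact h
      · rw [mem_ofPred_eq, Finset.sum_sub_distrib]
        simp only [mul_neg, Finset.sum_neg_distrib]
        linarith
    refine (measureReal_mono hsub).trans ((measureReal_union_le _ _).trans ?_)
    linarith

/-- A strong law of large numbers for triangular arrays of functions of the digits. -/
theorem ae_tendsto_average_sub (w : ℕ → PMF D) {f : ℕ → ℕ → D → ℝ} {C : ℝ} (hC : 0 < C)
    (hf : ∀ N k d, |f N k d| ≤ C) :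
    ∀ᵐ ω ∂productMeasure w, Tendsto (fun N : ℕ => (∑ k ∈ Finset.range N, f N k (ω k) -
      ∑ k ∈ Finset.range N, ∑ d, (w k d).toReal * f N k d) / N) atTop (𝓝 0) := by
  have h : ∀ j : ℕ, ∀ᵐ ω ∂productMeasure w, ∀ᶠ N : ℕ in atTop,
      ¬ (1 / ((j : ℝ) + 1) * N ≤ |∑ k ∈ Finset.range N, f N k (ω k) -
        ∑ k ∈ Finset.range N, ∑ d, (w k d).toReal * f N k d|) := fun j =>
    ae_eventually_notMem_of_exp_bound (by positivity) fun N =>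
      productMeasure_abs_sum_sub_ge_le w hC (hf N) le_rfl (by positivity)
  filter_upwards [ae_all_iff.2 h] with ω hω
  rw [Metric.tendsto_nhds]
  intro ε hε
  obtain ⟨j, hj⟩ := exists_nat_one_div_lt hε
  filter_upwards [hω j, eventually_gt_atTop 0] with N hN hN0
  have hN0' : (0 : ℝ) < N := by exact_mod_cast hN0
  rw [dist_zero_right, Real.norm_eq_abs, abs_div, abs_of_pos hN0', div_lt_iff₀ hN0']
  exact (not_le.1 hN).trans (by gcongr)

end Deviations

/-! ### Bernoulli measures of approximate squares and of balls -/

section Bernoulli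

variable {m n : ℕ} {D : Finset (Fin m × Fin n)}

/-- The logarithm of the factor that the `k`-th digit contributes to the Bernoulli measure of an
approximate square of level `N`. -/
noncomputable def squareTerm (p : PMF D) (N k : ℕ) (d : D) : ℝ :=
  if k < colLevel m n N then Real.log (p d).toReal else Real.log (rowProb p d.1.1)

/-- The logarithm of the Bernoulli measure of the approximate square of level `N`. -/
noncomputable def squareLog (p : PMF D) (N : ℕ) (ω : ℕ → D) : ℝ :=
  ∑ k ∈ Finset.range N, squareTerm p N k (ω k)

theorem pmf_toReal_pos {p : PMF D} (hp : ∀ d, p d ≠ 0) (d : D) : 0 < (p d).toReal :=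
  ENNReal.toReal_pos (hp d) (p.apply_ne_top d)

theorem pmf_le_rowProb (p : PMF D) (d : D) : (p d).toReal ≤ rowProb p d.1.1 := by
  rw [← pmf_real_singleton, ← pmf_real_row]
  exact measureReal_mono fun x hx => by rw [mem_singleton_iff.1 hx]; rfl

theorem rowProb_le_one (p : PMF D) (i : Fin m) : rowProb p i ≤ 1 := by
  rw [← pmf_real_row]
  exact measureReal_le_one

theorem pmf_toReal_le_one (p : PMF D) (d : D) : (p d).toReal ≤ 1 :=
  (pmf_le_rowProb p d).trans (rowProb_le_one p _)

theorem squareTerm_nonpos {p : PMF D} (N k : ℕ) (d : D) :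
    squareTerm p N k d ≤ 0 := by
  unfold squareTerm
  split_ifs
  · exact Real.log_nonpos ENNReal.toReal_nonneg (pmf_toReal_le_one p d)
  · exact Real.log_nonpos (ENNReal.toReal_nonneg.trans (pmf_le_rowProb p d)) (rowProb_le_one p _)

theorem exists_abs_squareTerm_le {p : PMF D} (hp : ∀ d, p d ≠ 0) :
    ∃ C > 0, ∀ N k d, |squareTerm p N k d| ≤ C := by
  refine ⟨1 + ∑ d, |Real.log (p d).toReal|, by positivity, fun N k d => ?_⟩
  have h1 : |squareTerm p N k d| ≤ |Real.log (p d).toReal| := by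
    rw [abs_of_nonpos (squareTerm_nonpos N k d), abs_of_nonpos
      (Real.log_nonpos ENNReal.toReal_nonneg (pmf_toReal_le_one p d)), neg_le_neg_iff, squareTerm]
    split_ifs
    · exact le_rfl
    · exact Real.log_le_log (pmf_toReal_pos hp d) (pmf_le_rowProb p d)
  have h2 := Finset.single_le_sum (f := fun d => |Real.log (p d).toReal|)
    (fun d _ => abs_nonneg _) (Finset.mem_univ d)
  linarith

theorem productMeasure_symbSquare {p : PMF D} (hp : ∀ d, p d ≠ 0) (N : ℕ) (ω : ℕ → D) :
    (productMeasure fun _ => p).real (symbSquare N ω) = Real.exp (squareLog p N ω) := by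
  rw [symbSquare, productMeasure_real_pi, squareLog, Real.exp_sum]
  refine Finset.prod_congr rfl fun k _ => ?_
  rw [squareTerm]
  split_ifs with hk
  · rw [toMeasure_cell_of_lt _ _ hk, Real.exp_log (pmf_toReal_pos hp _)]
  · rw [toMeasure_cell_of_le _ _ (not_lt.1 hk), Real.exp_log
      ((pmf_toReal_pos hp (ω k)).trans_le (pmf_le_rowProb p _))]

theorem exists_le_pmf [Nonempty D] {p : PMF D} (hp : ∀ d, p d ≠ 0) :
    ∃ δ > 0, ∀ d, δ ≤ (p d).toReal := by
  obtain ⟨d, hd⟩ := Finite.exists_min fun d => (p d).toReal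
  exact ⟨_, pmf_toReal_pos hp d, hd⟩

theorem bernoulliMeasure_closedBall (hm : 2 ≤ m) (hn : 2 ≤ n) (p : PMF D)
    (x : EuclideanSpace ℝ (Fin 2)) (r : ℝ) :
    (bernoulliMeasure D p).real (Metric.closedBall x r) =
      (productMeasure fun _ => p).real (codingMap D ⁻¹' Metric.closedBall x r) :=
  map_measureReal_apply (continuous_codingMap hm hn).measurable Metric.isClosed_closedBall.measurableSet

theorem le_bernoulliMeasure_closedBall (hm : 2 ≤ m) (hmn : m < n) {p : PMF D}
    (hp : ∀ d, p d ≠ 0) {N : ℕ} {r : ℝ} (hr : 2 / (m : ℝ) ^ N ≤ r) (ω : ℕ → D) :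
    Real.exp (squareLog p N ω) ≤
      (bernoulliMeasure D p).real (Metric.closedBall (codingMap D ω) r) := by
  rw [bernoulliMeasure_closedBall hm (by omega), ← productMeasure_symbSquare hp]
  exact measureReal_mono fun τ hτ => (dist_le_of_mem_symbSquare hm hmn hτ).trans hr

theorem bernoulliMeasure_closedBall_le (hm : 2 ≤ m) (hmn : m < n) {p : PMF D}
    (hp : ∀ d, p d ≠ 0) {N l : ℕ} {r : ℝ} (hr : r < 1 / ((m : ℝ) ^ N * (n : ℝ) ^ (l + 1)))
    {ω : ℕ → D} (hω : Spread N l ω) :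
    (bernoulliMeasure D p).real (Metric.closedBall (codingMap D ω) r) ≤
      Real.exp (squareLog p N ω) := by
  rw [bernoulliMeasure_closedBall hm (by omega), ← productMeasure_symbSquare hp]
  exact measureReal_mono fun τ hτ => mem_symbSquare_of_dist_lt hm hmn hω (hτ.trans_lt hr)

theorem approxSquare_eq (hm : 2 ≤ m) (hmn : m < n)
    (code : EuclideanSpace ℝ (Fin 2) → ℕ → D) (N : ℕ) (x : EuclideanSpace ℝ (Fin 2)) :
    approxSquare D code N x = {y ∈ carpet D | code y ∈ symbSquare N (code x)} := by
  ext y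
  exact and_congr_right fun _ => (mem_symbSquare hm hmn).symm

/-- Approximate squares need not be measurable, since the choice of codes is arbitrary; but they
agree up to a null set with the projection of a symbolic approximate square. -/
theorem bernoulliMeasure_approxSquare [Nonempty D] (hm : 2 ≤ m) (hmn : m < n) {p : PMF D}
    (hp : ∀ d, p d ≠ 0) {code : EuclideanSpace ℝ (Fin 2) → ℕ → D}
    (hcode : ∀ x ∈ carpet D, codingMap D (code x) = x) (N : ℕ)
    (x : EuclideanSpace ℝ (Fin 2)) :
    (bernoulliMeasure D p).real (approxSquare D code N x) =
      Real.exp (squareLog p N (code x)) := by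
  obtain ⟨δ, hδ0, hδ⟩ := exists_le_pmf hp
  have huniq := ae_code_unique hm hmn (w := fun _ => p) hδ0 fun _ => hδ
  have hcont := continuous_codingMap (D := D) hm (by omega : 2 ≤ n)
  rw [← productMeasure_symbSquare hp, measureReal_def, measureReal_def, approxSquare_eq hm hmn]
  congr 1
  set T := symbSquare N (code x)
  have hT : IsClosed T := isClosed_set_pi fun _ _ => isClosed_discrete _
  refine le_antisymm ?_ ?_
  -- The projection of the symbolic square is compact, hence measurable.
  · calc bernoulliMeasure D p {y ∈ carpet D | code y ∈ T}
        ≤ bernoulliMeasure D p (codingMap D '' T) :=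
          measure_mono fun y hy => ⟨code y, hy.2, hcode y hy.1⟩
      _ = productMeasure (fun _ => p) (codingMap D ⁻¹' (codingMap D '' T)) :=
          Measure.map_apply hcont.measurable (hT.isCompact.image hcont).measurableSet
      _ ≤ productMeasure (fun _ => p) T := by
          refine measure_mono_ae ?_
          filter_upwards [huniq] with ω hω hmem
          obtain ⟨τ, hτ, hτω⟩ := hmem
          exact hω τ hτω ▸ hτ
  · refine le_trans (measure_mono_ae ?_) (Measure.le_map_apply hcont.measurable.aemeasurable _)
    filter_upwards [huniq] with ω hω hmem
    refine ⟨mem_range_self ω, ?_⟩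
    rw [hω _ (hcode _ (mem_range_self ω))]
    exact hmem

end Bernoulli

/-! ### A measure of maximal packing dimension -/

section MaximalMeasure

variable {m n : ℕ} {D : Finset (Fin m × Fin n)}

/-- The places with uniform digits in the measure of maximal packing dimension: those between
`j!` and `⌈σ (j + 1)!⌉`, for some `j`. At the levels `N = (j + 1)!` this measure gives roughly the
same mass to all approximate squares, as the places before `j!` are negligible. -/
def blockSet (m n : ℕ) : Set ℕ :=
  {k | ∃ j : ℕ, j.factorial ≤ k ∧ k < colLevel m n (j + 1).factorial}

theorem notMem_blockSet (hm : 2 ≤ m) (hmn : m < n) {j k : ℕ} (h1 : k < (j + 1).factorial)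
    (h2 : colLevel m n (j + 1).factorial ≤ k) : k ∉ blockSet m n := by
  rintro ⟨i, hi1, hi2⟩
  have hij : i ≤ j := by
    by_contra! hlt
    exact absurd (Nat.factorial_le (Nat.succ_le_of_lt hlt)) (not_le.2 (hi1.trans_lt h1))
  exact absurd (colLevel_mono hm hmn (Nat.factorial_le (Nat.add_le_add_right hij 1)))
    (not_le.2 (h2.trans_lt hi2))

variable [Nonempty D]

theorem blockSet_symbSquare_le (hm : 2 ≤ m) (hmn : m < n) (j : ℕ) (ω : ℕ → D) :
    (productMeasure (mixture D (blockSet m n))).real (symbSquare (j + 1).factorial ω) ≤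
      (D.card : ℝ) ^ j.factorial *
        ((rows D).card * Real.exp (-((j + 1).factorial * squareEntropy D))) :=
  (mixture_symbSquare_le hm hmn (Nat.factorial_le j.le_succ) ω
    (fun _ h1 h2 => show _ ∈ blockSet m n from ⟨j, h1, h2⟩)
    fun _ _ h2 h3 => notMem_blockSet hm hmn h2 h3).trans
      (mul_le_mul_of_nonneg_left (squareMass_le hm hmn _) (by positivity))

theorem tendsto_factorial : Tendsto (fun j : ℕ => (j + 1).factorial) atTop atTop :=
  tendsto_atTop_mono (fun j => (Nat.le_succ j).trans (Nat.self_le_factorial _)) tendsto_id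

/-- For `s` below the box dimension, at the levels `(j + 1)!` with large `j` the mass of an
approximate square is at most the power `s` of a slightly smaller radius. -/
theorem eventually_blockSet_mass_le (hn : 2 ≤ n) {s : ℝ} (hs0 : 0 ≤ s)
    (hs : s * Real.log m < squareEntropy D) :
    ∃ ε : ℝ, 0 < ε ∧ ∀ᶠ j : ℕ in atTop,
      j.factorial * Real.log D.card + (Real.log (rows D).card +
        -((j + 1).factorial * squareEntropy D)) ≤
      s * -(Real.log 10 + ((j + 1).factorial * Real.log m +
        ((⌊ε * ((j + 1).factorial : ℝ)⌋₊ : ℝ) + 1) * Real.log n)) := by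
  have hn0 : 0 < Real.log n := Real.log_pos (by exact_mod_cast hn)
  have hL0 : 0 ≤ Real.log D.card := Real.log_nonneg (by exact_mod_cast card_pos_of_nonempty)
  set κ := squareEntropy D - s * Real.log m with hκ
  have hκ0 : 0 < κ := by linarith
  set ε := κ / (3 * (s * Real.log n + 1)) with hε
  have hden : 0 < s * Real.log n + 1 := by positivity
  refine ⟨ε, by positivity, ?_⟩
  have hlarge : ∀ c : ℝ, ∀ᶠ j : ℕ in atTop, c ≤ κ / 3 * ((j + 1).factorial : ℝ) := fun c =>
    ((tendsto_natCast_atTop_atTop.comp tendsto_factorial).const_mul_atTop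
      (by positivity : 0 < κ / 3)).eventually_ge_atTop c
  have hlarge' : ∀ᶠ j : ℕ in atTop, Real.log D.card ≤ κ / 3 * ((j : ℝ) + 1) :=
    ((tendsto_natCast_atTop_atTop.atTop_add tendsto_const_nhds).const_mul_atTop
      (by positivity : 0 < κ / 3)).eventually_ge_atTop _
  filter_upwards [hlarge (Real.log (rows D).card + s * (Real.log n + Real.log 10)), hlarge']
    with j h1 h2
  set N : ℝ := ((j + 1).factorial : ℝ) with hN
  have hNj : N = (j + 1) * (j.factorial : ℝ) := by
    rw [hN, Nat.factorial_succ]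
    push_cast
    ring
  have hN0 : 0 ≤ N := Nat.cast_nonneg _
  have h3 : (j.factorial : ℝ) * Real.log D.card ≤ κ / 3 * N := by
    rw [hNj]
    nlinarith [(Nat.cast_nonneg j.factorial : (0 : ℝ) ≤ _)]
  have h4 : (⌊ε * N⌋₊ : ℝ) ≤ ε * N := Nat.floor_le (by positivity)
  have h5 : s * Real.log n * ε ≤ κ / 3 := by
    rw [hε, mul_div_assoc', div_le_iff₀ (by positivity)]
    nlinarith
  have h6 : s * Real.log n * (⌊ε * N⌋₊ : ℝ) ≤ κ / 3 * N :=
    calc s * Real.log n * (⌊ε * N⌋₊ : ℝ) ≤ s * Real.log n * (ε * N) := by gcongr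
      _ = s * Real.log n * ε * N := by ring
      _ ≤ κ / 3 * N := by gcongr
  have h7 : squareEntropy D = κ + s * Real.log m := by rw [hκ]; ring
  rw [h7]
  nlinarith

/-- The projection of a set of full measure has at least the box dimension of the carpet as its
packing dimension. -/
theorem le_dimP_image (hm : 2 ≤ m) (hmn : m < n) {G : Set (ℕ → D)}
    (hG : ∀ᵐ ω ∂productMeasure (mixture D (blockSet m n)), ω ∈ G) :
    ENNReal.ofReal (squareEntropy D / Real.log m) ≤ dimP (codingMap D '' G) := by
  have hm1 : (1 : ℝ) < m := by exact_mod_cast hm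
  have hm0 : (0 : ℝ) < m := by linarith
  have hn0 : (0 : ℝ) < n := by exact_mod_cast (by omega : 0 < n)
  have hn1 : (1 : ℝ) ≤ n := by exact_mod_cast (by omega : 1 ≤ n)
  have hL1 : (0 : ℝ) < (rows D).card := by exact_mod_cast card_rows_pos
  have hL0 : (0 : ℝ) < D.card := by exact_mod_cast card_pos_of_nonempty
  have hlog : 0 < Real.log m := Real.log_pos hm1
  set ν := productMeasure (mixture D (blockSet m n)) with hν
  have hmeas := (continuous_codingMap (D := D) hm (by omega : 2 ≤ n)).measurable
  refine ofReal_le_dimP fun s hs => ?_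
  rw [lt_div_iff₀ hlog] at hs
  obtain ⟨ε, hε, hev⟩ := eventually_blockSet_mass_le (D := D) (by omega : 2 ≤ n) s.coe_nonneg hs
  have hspread := ae_eventually_spread (w := mixture D (blockSet m n)) (by positivity)
    (le_mixture (blockSet m n)) hε
  set G' := {ω | ω ∈ G ∧ ∀ᶠ N : ℕ in atTop, Spread N ⌊ε * N⌋₊ ω} with hG'
  have hfull : ν G'ᶜ = 0 := by
    have : ∀ᵐ ω ∂ν, ω ∈ G' := hG.and hspread
    exact this
  have hone : ν G' ≠ 0 := fun h0 => by
    have h1 : ν univ ≤ ν G' + ν G'ᶜ := by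
      rw [← union_compl_self G']
      exact measure_union_le _ _
    rw [h0, hfull, measure_univ] at h1
    simp at h1
  have hle : (ν.map (codingMap D)) (codingMap D '' G') ≤ packingMeasure s (codingMap D '' G') := by
    refine measure_le_packingMeasure _ ?_
    rintro _ ⟨ω, ⟨-, hω⟩, rfl⟩ ρ hρ
    have hsmall : Tendsto (fun j : ℕ => 1 / (m : ℝ) ^ (j + 1).factorial) atTop (𝓝 0) :=
      (by simpa [Function.comp_def] using
        tendsto_inv_atTop_zero.comp (tendsto_pow_atTop_atTop_of_one_lt hm1) :
        Tendsto (fun N : ℕ => 1 / (m : ℝ) ^ N) atTop (𝓝 0)).comp tendsto_factorial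
    obtain ⟨j, hj1, hj2, hj3⟩ := (hev.and ((tendsto_factorial.eventually hω).and
      (hsmall.eventually_lt_const hρ))).exists
    set N := (j + 1).factorial
    set l := ⌊ε * N⌋₊
    set r : ℝ := 1 / (10 * ((m : ℝ) ^ N * (n : ℝ) ^ (l + 1))) with hr
    have hpow : 1 ≤ (n : ℝ) ^ (l + 1) := one_le_pow₀ hn1
    have hpow' : 0 < (m : ℝ) ^ N := by positivity
    refine ⟨r, by positivity, lt_of_le_of_lt (one_div_le_one_div_of_le hpow' ?_) hj3, ?_⟩
    · nlinarith
    rw [Measure.map_apply hmeas Metric.isClosed_closedBall.measurableSet,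
      ENNReal.ofReal_rpow_of_nonneg (by positivity) s.coe_nonneg, ← ofReal_measureReal]
    refine ENNReal.ofReal_le_ofReal ?_
    have hsub : codingMap D ⁻¹' Metric.closedBall (codingMap D ω) (5 * r) ⊆ symbSquare N ω := by
      refine fun τ hτ => mem_symbSquare_of_dist_lt hm hmn hj2 (lt_of_le_of_lt hτ ?_)
      have : 5 * r = (1 / 2) * (1 / ((m : ℝ) ^ N * (n : ℝ) ^ (l + 1))) := by
        rw [hr]
        field_simp
        norm_num
      rw [this]
      have : 0 < 1 / ((m : ℝ) ^ N * (n : ℝ) ^ (l + 1)) := by positivity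
      linarith
    refine (measureReal_mono hsub).trans ((blockSet_symbSquare_le hm hmn j ω).trans ?_)
    have hr0 : 0 < r := by positivity
    rw [← Real.log_le_log_iff (by positivity) (by positivity), Real.log_rpow hr0,
      Real.log_mul (by positivity) (by positivity), Real.log_mul hL1.ne' (Real.exp_ne_zero _),
      Real.log_exp, Real.log_pow, hr, one_div, Real.log_inv, Real.log_mul (by norm_num)
      (by positivity), Real.log_mul (by positivity) (by positivity), Real.log_pow, Real.log_pow]
    push_cast
    exact hj1
  intro h0
  refine hone (le_antisymm ?_ zero_le)
  calc ν G' ≤ ν (codingMap D ⁻¹' (codingMap D '' G')) := measure_mono (subset_preimage_image _ _)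
    _ ≤ ν.map (codingMap D) (codingMap D '' G') :=
        Measure.le_map_apply hmeas.aemeasurable _
    _ ≤ packingMeasure s (codingMap D '' G') := hle
    _ ≤ packingMeasure s (codingMap D '' G) :=
        packingMeasure_mono s (image_mono fun _ h => h.1)
    _ = 0 := h0

theorem le_dimP_carpet (hm : 2 ≤ m) (hmn : m < n) :
    ENNReal.ofReal (squareEntropy D / Real.log m) ≤ dimP (carpet D) := by
  rw [carpet, ← image_univ]
  exact le_dimP_image hm hmn (ae_of_all _ fun _ => mem_univ _)

end MaximalMeasure

/-! ### From squares to balls -/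

section Balls

variable {m n : ℕ} {D : Finset (Fin m × Fin n)}

theorem tendsto_ceil_affine_div {c d : ℝ} (hd : 0 < d) :
    Tendsto (fun R : ℝ => (⌈(R + c) / d⌉₊ : ℝ) / R) atTop (𝓝 (1 / d)) := by
  have h1 : Tendsto (fun R : ℝ => (R + c) / d) atTop atTop :=
    (tendsto_atTop_add_const_right _ c tendsto_id).atTop_div_const hd
  have h2 := (tendsto_nat_ceil_div_atTop (R := ℝ)).comp h1
  have h3 : Tendsto (fun R : ℝ => (1 + c / R) / d) atTop (𝓝 ((1 + 0) / d)) :=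
    ((tendsto_const_nhds.div_atTop tendsto_id).const_add 1).div_const d
  have h4 := h2.mul h3
  rw [add_zero, one_mul] at h4
  refine h4.congr' ?_
  filter_upwards [eventually_gt_atTop 0, h1.eventually_gt_atTop 0] with R hR hR'
  have : (R + c) / d = (1 + c / R) / d * R := by field_simp
  simp only [Function.comp]
  rw [div_mul_eq_mul_div, div_eq_div_iff hR'.ne' hR.ne']
  rw [mul_assoc, ← this]

theorem tendsto_floor_affine_div {c d : ℝ} (hd : 0 < d) :
    Tendsto (fun R : ℝ => (⌊(R + c) / d⌋₊ : ℝ) / R) atTop (𝓝 (1 / d)) := by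
  have h1 : Tendsto (fun R : ℝ => (R + c) / d) atTop atTop :=
    (tendsto_atTop_add_const_right _ c tendsto_id).atTop_div_const hd
  have h2 := (tendsto_nat_floor_div_atTop (R := ℝ)).comp h1
  have h3 : Tendsto (fun R : ℝ => (1 + c / R) / d) atTop (𝓝 ((1 + 0) / d)) :=
    ((tendsto_const_nhds.div_atTop tendsto_id).const_add 1).div_const d
  have h4 := h2.mul h3
  rw [add_zero, one_mul] at h4
  refine h4.congr' ?_
  filter_upwards [eventually_gt_atTop 0, h1.eventually_gt_atTop 0] with R hR hR'
  have : (R + c) / d = (1 + c / R) / d * R := by field_simp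
  simp only [Function.comp]
  rw [div_mul_eq_mul_div, div_eq_div_iff hR'.ne' hR.ne']
  rw [mul_assoc, ← this]

/-- If the point coded by `ω` is well inside its approximate squares, then its local dimension is
given by the measures of these squares. -/
theorem tendsto_log_closedBall_div (hm : 2 ≤ m) (hmn : m < n) {p : PMF D} (hp : ∀ d, p d ≠ 0)
    {ω : ℕ → D} {Φ : ℝ} (hΦ : Tendsto (fun N : ℕ => squareLog p N ω / N) atTop (𝓝 Φ))
    (hω : ∀ j : ℕ, ∀ᶠ N : ℕ in atTop, Spread N ⌊1 / ((j : ℝ) + 1) * N⌋₊ ω) :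
    Tendsto (fun r : ℝ => Real.log ((bernoulliMeasure D p).real
      (Metric.closedBall (codingMap D ω) r)) / Real.log r) (𝓝[>] 0) (𝓝 (-Φ / Real.log m)) := by
  have hm0 : (0 : ℝ) < m := by positivity
  have hn0 : (0 : ℝ) < n := by exact_mod_cast (by omega : 0 < n)
  have hlm : 0 < Real.log m := Real.log_pos (by exact_mod_cast hm)
  have hln : 0 < Real.log n := Real.log_pos (by exact_mod_cast (by omega : 1 < n))
  have hR : Tendsto (fun r : ℝ => -Real.log r) (𝓝[>] 0) atTop :=
    tendsto_neg_atBot_atTop.comp Real.tendsto_log_nhdsGT_zero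
  set μ := bernoulliMeasure D p
  -- The exponential rates of the squares whose levels are given by a function of `R = -log r`.
  have hrate : ∀ (N : ℝ → ℕ) (d : ℝ), 0 < d → Tendsto (fun R => (N R : ℝ) / R) atTop (𝓝 (1 / d)) →
      Tendsto N atTop atTop →
      Tendsto (fun R => -squareLog p (N R) ω / R) atTop (𝓝 (-Φ / d)) := by
    intro N d hd h1 h2
    have h3 := ((hΦ.comp h2).neg).mul h1
    rw [mul_one_div] at h3
    refine h3.congr' ?_
    filter_upwards [h2.eventually_gt_atTop 0] with R hR
    have : (N R : ℝ) ≠ 0 := by exact_mod_cast hR.ne'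
    simp only [Function.comp]
    field_simp
  -- The square of this level has diameter at most `r`.
  have hlow : ∀ r > 0, Real.exp (squareLog p ⌈(-Real.log r + Real.log 2) / Real.log m⌉₊ ω) ≤
      μ.real (Metric.closedBall (codingMap D ω) r) := by
    refine fun r hr => le_bernoulliMeasure_closedBall hm hmn hp ?_ ω
    rw [div_le_comm₀ (by positivity) hr, ← Real.log_le_log_iff (by positivity) (by positivity),
      Real.log_div (by norm_num) hr.ne', Real.log_pow, ← div_le_iff₀ hlm]
    refine le_trans (le_of_eq ?_) (Nat.le_ceil _)
    ring
  have hpos : ∀ r > 0, 0 < μ.real (Metric.closedBall (codingMap D ω) r) := fun r hr =>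
    (Real.exp_pos _).trans_le (hlow r hr)
  have hlt1 : ∀ᶠ r : ℝ in 𝓝[>] 0, Real.log r < 0 := by
    filter_upwards [hR.eventually_gt_atTop 0] with r hr using neg_pos.1 hr
  rw [tendsto_order]
  constructor
  -- The excluded runs change the exponent only by a factor that tends to `1` as `j → ∞`.
  · intro a ha
    have hlim : Tendsto (fun j : ℕ => -Φ / (Real.log m + 1 / ((j : ℝ) + 1) * Real.log n)) atTop
        (𝓝 (-Φ / (Real.log m + 0 * Real.log n))) :=
      tendsto_const_nhds.div ((tendsto_one_div_add_atTop_nhds_zero_nat.mul_const _).const_add _)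
        (by rw [zero_mul, add_zero]; exact hlm.ne')
    rw [zero_mul, add_zero] at hlim
    obtain ⟨j, hj⟩ := (hlim.eventually_const_lt ha).exists
    set ε : ℝ := 1 / ((j : ℝ) + 1) with hε
    have hε0 : 0 < ε := by positivity
    set d := Real.log m + ε * Real.log n with hd
    have hd0 : 0 < d := by positivity
    have hN : Tendsto (fun R : ℝ => ⌊(R + -(Real.log n + 1)) / d⌋₊) atTop atTop :=
      tendsto_nat_floor_atTop.comp
        ((tendsto_atTop_add_const_right _ _ tendsto_id).atTop_div_const hd0)
    have hf := (hrate _ d hd0 (tendsto_floor_affine_div hd0) hN).comp hR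
    filter_upwards [hf.eventually_const_lt hj, (hN.comp hR).eventually (hω j), hlt1,
      self_mem_nhdsWithin, hR.eventually_gt_atTop (Real.log n + 1)] with r h1 h2 h3 hr h4
    refine h1.trans_le ?_
    simp only [Function.comp] at h1 h2 ⊢
    set N := ⌊(-Real.log r + -(Real.log n + 1)) / d⌋₊ with hNdef
    rw [← neg_div_neg_eq (Real.log (μ.real _))]
    have hr' : (0 : ℝ) < r := hr
    have hle : μ.real (Metric.closedBall (codingMap D ω) r) ≤ Real.exp (squareLog p N ω) := by
      refine bernoulliMeasure_closedBall_le hm hmn hp ?_ h2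
      rw [lt_one_div hr' (by positivity), ← Real.log_lt_log_iff (by positivity) (by positivity),
        Real.log_mul (by positivity) (by positivity), Real.log_pow, Real.log_pow, one_div r,
        Real.log_inv]
      have h5 : (N : ℝ) ≤ (-Real.log r + -(Real.log n + 1)) / d :=
        Nat.floor_le (div_nonneg (by linarith) hd0.le)
      rw [le_div_iff₀ hd0] at h5
      have h6 : (⌊ε * (N : ℝ)⌋₊ : ℝ) ≤ ε * N := Nat.floor_le (by positivity)
      push_cast
      nlinarith
    have hlog := Real.log_le_log (hpos r hr) hle
    rw [Real.log_exp] at hlog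
    gcongr
    linarith
  · intro b hb
    have hN : Tendsto (fun R : ℝ => ⌈(R + Real.log 2) / Real.log m⌉₊) atTop atTop :=
      tendsto_nat_ceil_atTop.comp
        ((tendsto_atTop_add_const_right _ _ tendsto_id).atTop_div_const hlm)
    have hf := (hrate _ _ hlm (tendsto_ceil_affine_div hlm) hN).comp hR
    filter_upwards [hf.eventually_lt_const hb, hlt1, self_mem_nhdsWithin] with r h1 h3 hr
    refine lt_of_le_of_lt ?_ h1
    have hlog := Real.log_le_log (Real.exp_pos _) (hlow r hr)
    rw [Real.log_exp] at hlog
    simp only [Function.comp]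
    rw [← neg_div_neg_eq (Real.log (μ.real _))]
    gcongr
    linarith

end Balls

/-! ### Means of the local exponents -/

section Means

variable {m n : ℕ} {D : Finset (Fin m × Fin n)} [Nonempty D]

theorem sum_uniform_log (p : PMF D) :
    ∑ d, (PMF.uniformOfFintype D d).toReal * Real.log (p d).toReal =
      ∑ d : D, 1 / (D.card : ℝ) * Real.log (p d).toReal :=
  Finset.sum_congr rfl fun d _ => by rw [uniform_apply_toReal]

theorem sum_rowUniform_log (p : PMF D) :
    ∑ d, (rowUniform D d).toReal * Real.log (p d).toReal =
      ∑ d : D, 1 / ((rowCount D d.1.1 : ℝ) * ((rows D).card : ℝ)) * Real.log (p d).toReal :=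
  Finset.sum_congr rfl fun d _ => by rw [rowUniform_apply_toReal]

theorem sum_uniform_log_row (p : PMF D) :
    ∑ d, (PMF.uniformOfFintype D d).toReal * Real.log (rowProb p d.1.1) =
      ∑ i ∈ rows D, (rowCount D i : ℝ) / (D.card : ℝ) * Real.log (rowProb p i) := by
  simp only [uniform_apply_toReal]
  rw [sum_row D fun i => 1 / (D.card : ℝ) * Real.log (rowProb p i)]
  exact Finset.sum_congr rfl fun i _ => by ring

theorem sum_rowUniform_log_row (p : PMF D) :
    ∑ d, (rowUniform D d).toReal * Real.log (rowProb p d.1.1) =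
      ∑ i ∈ rows D, 1 / ((rows D).card : ℝ) * Real.log (rowProb p i) := by
  simp only [rowUniform_apply_toReal]
  exact sum_div_rowCount D fun i => Real.log (rowProb p i)

theorem sum_range_ite {c N : ℕ} (h : c ≤ N) (x y : ℝ) :
    ∑ k ∈ Finset.range N, (if k < c then x else y) = c * x + (N - c) * y := by
  obtain ⟨j, rfl⟩ := Nat.exists_eq_add_of_le h
  rw [Finset.sum_range_add, Finset.sum_congr rfl fun k hk => if_pos (Finset.mem_range.1 hk)]
  simp

/-- If uniform digits and digits with uniform rows have the same mean exponents, then these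
exponents are almost surely attained by any mixture. -/
theorem ae_tendsto_squareLog_div (hm : 2 ≤ m) (hmn : m < n) {p : PMF D} (hp : ∀ d, p d ≠ 0)
    (S : Set ℕ) {A B : ℝ}
    (hA1 : ∑ i ∈ rows D, 1 / ((rows D).card : ℝ) * Real.log (rowProb p i) = A)
    (hA2 : ∑ i ∈ rows D, (rowCount D i : ℝ) / (D.card : ℝ) * Real.log (rowProb p i) = A)
    (hB1 : ∑ d : D, 1 / (D.card : ℝ) * Real.log (p d).toReal = B)
    (hB2 : ∑ d : D, 1 / ((rowCount D d.1.1 : ℝ) * ((rows D).card : ℝ)) *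
      Real.log (p d).toReal = B) :
    ∀ᵐ ω ∂productMeasure (mixture D S), Tendsto (fun N : ℕ => squareLog p N ω / N) atTop
      (𝓝 (sigma m n * B + (1 - sigma m n) * A)) := by
  obtain ⟨C, hC, hCb⟩ := exists_abs_squareTerm_le hp
  have hmean : ∀ N k, ∑ d, (mixture D S k d).toReal * squareTerm p N k d =
      if k < colLevel m n N then B else A := by
    intro N k
    unfold squareTerm
    by_cases hk : k ∈ S
    · rw [mixture_of_mem hk]
      split_ifs
      · rw [sum_uniform_log, hB1]
      · rw [sum_uniform_log_row, hA2]
    · rw [mixture_of_notMem hk]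
      split_ifs
      · rw [sum_rowUniform_log, hB2]
      · rw [sum_rowUniform_log_row, hA1]
  filter_upwards [ae_tendsto_average_sub (mixture D S) hC hCb] with ω hω
  simp only [hmean] at hω
  have h1 : Tendsto (fun N : ℕ => (colLevel m n N : ℝ) / N * (B - A) + A) atTop
      (𝓝 (sigma m n * (B - A) + A)) := ((tendsto_colLevel_div hm hmn).mul_const _).add_const _
  have h2 := hω.add h1
  rw [zero_add, show sigma m n * (B - A) + A = sigma m n * B + (1 - sigma m n) * A by ring] at h2
  refine h2.congr' ?_
  filter_upwards [eventually_gt_atTop 0] with N hN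
  have hN' : (N : ℝ) ≠ 0 := by exact_mod_cast hN.ne'
  rw [sum_range_ite (colLevel_le hm hmn N), squareLog]
  field_simp
  ring

end Means

/-! ### Level sets of full packing dimension -/

section FullDimension

variable {m n : ℕ} {D : Finset (Fin m × Fin n)} [Nonempty D]

theorem ae_mem_symbLevelSet (hm : 2 ≤ m) (hmn : m < n) {p : PMF D} (hp : ∀ d, p d ≠ 0)
    {code : EuclideanSpace ℝ (Fin 2) → ℕ → D} (hcode : ∀ x ∈ carpet D, codingMap D (code x) = x)
    {S : Set ℕ} {Φ : ℝ} (hΦ : ∀ᵐ ω ∂productMeasure (mixture D S),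
      Tendsto (fun N : ℕ => squareLog p N ω / N) atTop (𝓝 Φ)) :
    ∀ᵐ ω ∂productMeasure (mixture D S),
      codingMap D ω ∈ symbLevelSet D p code (-(1 / Real.log m) * Φ) := by
  have hL0 : (0 : ℝ) < D.card := by exact_mod_cast card_pos_of_nonempty
  filter_upwards [hΦ, ae_code_unique hm hmn (by positivity) (le_mixture S)] with ω h1 h2
  refine ⟨mem_range_self ω, ?_⟩
  simp only [bernoulliMeasure_approxSquare hm hmn hp hcode, Real.log_exp,
    h2 _ (hcode _ (mem_range_self ω))]
  refine (h1.const_mul (-(1 / Real.log m))).congr fun N => ?_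
  rw [neg_mul, neg_mul, div_neg, div_mul_div_comm, one_mul, mul_comm (N : ℝ)]

theorem ae_mem_realLevelSet (hm : 2 ≤ m) (hmn : m < n) {p : PMF D} (hp : ∀ d, p d ≠ 0)
    {S : Set ℕ} {Φ : ℝ} (hΦ : ∀ᵐ ω ∂productMeasure (mixture D S),
      Tendsto (fun N : ℕ => squareLog p N ω / N) atTop (𝓝 Φ)) :
    ∀ᵐ ω ∂productMeasure (mixture D S),
      codingMap D ω ∈ realLevelSet D p (-(1 / Real.log m) * Φ) := by
  have hL0 : (0 : ℝ) < D.card := by exact_mod_cast card_pos_of_nonempty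
  have hspread : ∀ᵐ ω ∂productMeasure (mixture D S), ∀ j : ℕ, ∀ᶠ N : ℕ in atTop,
      Spread N ⌊1 / ((j : ℝ) + 1) * N⌋₊ ω :=
    ae_all_iff.2 fun j => ae_eventually_spread (by positivity) (le_mixture S) (by positivity)
  filter_upwards [hΦ, hspread] with ω h1 h2
  refine ⟨mem_range_self ω, ?_⟩
  rw [show -(1 / Real.log m) * Φ = -Φ / Real.log m by ring]
  exact tendsto_log_closedBall_div hm hmn hp h1 h2

/-- Full measure for the measure of maximal packing dimension implies full packing dimension. -/
theorem dimP_eq_carpet_of_ae_mem (hm : 2 ≤ m) (hmn : m < n)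
    {code : EuclideanSpace ℝ (Fin 2) → ℕ → D} (hcode : ∀ x ∈ carpet D, codingMap D (code x) = x)
    {X : Set (EuclideanSpace ℝ (Fin 2))} (hX : X ⊆ carpet D)
    (h : ∀ᵐ ω ∂productMeasure (mixture D (blockSet m n)), codingMap D ω ∈ X) :
    dimP X = dimP (carpet D) :=
  le_antisymm (dimP_mono hX) ((dimP_carpet_le hm hmn hcode).trans
    ((le_dimP_image hm hmn (G := codingMap D ⁻¹' X) h).trans
      (dimP_mono (image_preimage_subset _ _))))

end FullDimension

/-! ### Two incompatible scales -/

section TwoScales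

variable {m n : ℕ} {D : Finset (Fin m × Fin n)}

theorem noRun_congr {β : Type*} {f : D → β} {a l : ℕ} {ω τ : ℕ → D}
    (h : ∀ k < a + l, f (τ k) = f (ω k)) (hω : NoRun f a l ω) : NoRun f a l τ := by
  refine hω.imp_left ?_
  rintro ⟨k, hk, k', hk', hne⟩
  exact ⟨k, hk, k', hk', by rwa [h k hk.2, h k' hk'.2]⟩

theorem spread_of_mem_symbSquare (hm : 2 ≤ m) (hmn : m < n) {M N l : ℕ} {ω τ : ℕ → D}
    (h : τ ∈ symbSquare M ω) (h1 : N + l ≤ M) (h2 : colLevel m n N + l ≤ colLevel m n M)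
    (hω : Spread N l ω) : Spread N l τ := by
  rw [mem_symbSquare hm hmn] at h
  exact ⟨noRun_congr (fun k hk => h.1 k (hk.trans_le h1)) hω.1,
    noRun_congr (fun k hk => h.2 k (hk.trans_le h2)) hω.2⟩

/-- The squares of level `N ≤ M` around a point depend only on its square of level `M`. -/
theorem squareLog_of_mem_symbSquare (hm : 2 ≤ m) (hmn : m < n) (p : PMF D) {M N : ℕ}
    {ω τ : ℕ → D} (h : τ ∈ symbSquare M ω) (hN : N ≤ M) : squareLog p N τ = squareLog p N ω := by
  rw [mem_symbSquare hm hmn] at h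
  refine Finset.sum_congr rfl fun k hk => ?_
  have hk' : k < M := (Finset.mem_range.1 hk).trans_le hN
  unfold squareTerm
  split_ifs with hc
  · rw [show τ k = ω k from Subtype.ext (Prod.ext (h.1 k hk')
      (h.2 k (hc.trans_le (colLevel_mono hm hmn hN))))]
  · rw [h.1 k hk']

variable (m n) in
/-- The larger of the two scales at which squares of level `M` are examined: slightly less
than `M`, to leave room for the runs that decide whether a point is well inside its square. -/
noncomputable def outerLevel (ε : ℝ) (M : ℕ) : ℕ := ⌊(1 - ε) * M⌋₊

variable (m n) in
/-- The length of the excluded runs. -/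
noncomputable def runLength (ε : ℝ) (M : ℕ) : ℕ := ⌊sigma m n * ε * M⌋₊

/-- The mean of `squareLog p N` under the measure equidistributed on the squares of level `M`. -/
noncomputable def meanLog [Nonempty D] (p : PMF D) (M N : ℕ) : ℝ :=
  ∑ k ∈ Finset.range N, ∑ d, (mixture D (Iio (colLevel m n M)) k d).toReal * squareTerm p N k d

/-- The sequences that, at the scales `N ≈ (1 - ε) M` and `⌈σN⌉`, have long runs or an atypical
measure of their approximate square. -/
def atypical [Nonempty D] (p : PMF D) (ε η : ℝ) (M : ℕ) : Set (ℕ → D) :=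
  {ω | ¬ Spread (outerLevel ε M) (runLength m n ε M) ω} ∪
  {ω | ¬ Spread (colLevel m n (outerLevel ε M)) (runLength m n ε M) ω} ∪
  ({ω | η * M ≤ |squareLog p (outerLevel ε M) ω - meanLog p M (outerLevel ε M)|} ∪
  {ω | η * M ≤ |squareLog p (colLevel m n (outerLevel ε M)) ω -
    meanLog p M (colLevel m n (outerLevel ε M))|})

theorem outerLevel_le {ε : ℝ} (h1 : ε < 1) (M : ℕ) :
    (outerLevel ε M : ℝ) ≤ (1 - ε) * M :=
  Nat.floor_le (mul_nonneg (by linarith) M.cast_nonneg)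

theorem outerLevel_le_self {ε : ℝ} (h0 : 0 < ε) (h1 : ε < 1) (M : ℕ) : outerLevel ε M ≤ M := by
  have : (outerLevel ε M : ℝ) ≤ M :=
    (outerLevel_le h1 M).trans (by nlinarith [M.cast_nonneg (α := ℝ)])
  exact_mod_cast this

theorem outerLevel_add_runLength_le (hm : 2 ≤ m) (hmn : m < n) {ε : ℝ} (h0 : 0 < ε) (h1 : ε < 1)
    (M : ℕ) : outerLevel ε M + runLength m n ε M ≤ M := by
  have hs0 := sigma_pos hm hmn
  have hs1 := sigma_lt_one hm hmn
  have hN := outerLevel_le h1 M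
  have hl : (runLength m n ε M : ℝ) ≤ sigma m n * ε * M := Nat.floor_le (by positivity)
  have : sigma m n * ε * M ≤ ε * M := by
    rw [mul_assoc]
    exact mul_le_of_le_one_left (by positivity) hs1.le
  have h : (outerLevel ε M : ℝ) + runLength m n ε M ≤ M := by linarith
  exact_mod_cast h

theorem colLevel_add_runLength_le (hm : 2 ≤ m) (hmn : m < n) {ε : ℝ} (h0 : 0 < ε) (h1 : ε < 1)
    (M : ℕ) : colLevel m n (outerLevel ε M) + runLength m n ε M ≤ colLevel m n M := by
  have hs0 := sigma_pos hm hmn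
  have hN := outerLevel_le h1 M
  have hl : (runLength m n ε M : ℝ) ≤ sigma m n * ε * M := Nat.floor_le (by positivity)
  rw [colLevel, ← Nat.ceil_add_natCast (by positivity)]
  refine Nat.ceil_mono ?_
  nlinarith

theorem symbSquare_subset_atypical [Nonempty D] (hm : 2 ≤ m) (hmn : m < n) (p : PMF D) {ε η : ℝ}
    (h0 : 0 < ε) (h1 : ε < 1) (M : ℕ) {ω : ℕ → D} (hω : ω ∈ atypical p ε η M) :
    symbSquare M ω ⊆ atypical p ε η M := by
  intro τ hτ
  have hsymm : ω ∈ symbSquare M τ := by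
    rw [mem_symbSquare hm hmn] at hτ ⊢
    exact ⟨fun k hk => (hτ.1 k hk).symm, fun k hk => (hτ.2 k hk).symm⟩
  have hN := outerLevel_le_self h0 h1 M
  have hcN := colLevel_le hm hmn (outerLevel ε M)
  have hcl := colLevel_add_runLength_le hm hmn h0 h1 M
  have hNl := outerLevel_add_runLength_le hm hmn h0 h1 M
  have hmono := colLevel_mono hm hmn hcN
  simp only [atypical, mem_union, mem_ofPred_eq] at hω ⊢
  rw [squareLog_of_mem_symbSquare hm hmn p hτ hN,
    squareLog_of_mem_symbSquare hm hmn p hτ (hcN.trans hN)]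
  refine hω.imp_left (Or.imp (fun h h' => h ?_) fun h h' => h ?_)
  · exact spread_of_mem_symbSquare hm hmn hsymm hNl hcl h'
  · exact spread_of_mem_symbSquare hm hmn hsymm (by omega) (by omega) h'

/-- By Hoeffding's inequality and the estimate for runs, the atypical sequences form an
exponentially small part of the squares of level `M`. -/
theorem exists_atypical_bound [Nonempty D] (hm : 2 ≤ m) (hmn : m < n) {p : PMF D}
    (hp : ∀ d, p d ≠ 0) {ε η : ℝ} (h0 : 0 < ε) (h1 : ε < 1) (hη : 0 < η) :
    ∃ K c : ℝ, 0 < c ∧ ∀ M : ℕ, (productMeasure (mixture D (Iio (colLevel m n M)))).real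
      (atypical p ε η M) ≤ K * Real.exp (-(c * M)) := by
  obtain ⟨C, hC, hCb⟩ := exists_abs_squareTerm_le hp
  have hs0 := sigma_pos hm hmn
  have hL0 : (0 : ℝ) < D.card := by exact_mod_cast card_pos_of_nonempty
  set δ : ℝ := 1 / ((D.card : ℝ) * D.card) with hδ
  have hδ0 : 0 < δ := by positivity
  set c := min (δ * (sigma m n * ε)) (η ^ 2 / (2 * C ^ 2)) with hc
  refine ⟨4 * D.card * Real.exp δ + 4, c, by positivity, fun M => ?_⟩
  set P := productMeasure (mixture D (Iio (colLevel m n M)))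
  have hspread : ∀ N, P.real {ω | ¬ Spread N (runLength m n ε M) ω} ≤
      2 * D.card * Real.exp δ * Real.exp (-(c * M)) := fun N => by
    refine (productMeasure_not_spread_le (le_mixture _) N _).trans ?_
    rw [mul_assoc (2 * (D.card : ℝ)), ← Real.exp_add]
    gcongr
    have h2 : sigma m n * ε * M < runLength m n ε M + 1 := Nat.lt_floor_add_one _
    have h3 : c * M ≤ δ * (sigma m n * ε) * M := by gcongr; exact min_le_left _ _
    rw [← hδ]
    nlinarith
  have hdev : ∀ N ≤ M, P.real {ω | η * M ≤ |squareLog p N ω - meanLog p M N|} ≤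
      2 * Real.exp (-(c * M)) := fun N hN => by
    refine (productMeasure_abs_sum_sub_ge_le _ hC (hCb N) hN hη).trans ?_
    gcongr
    exact min_le_right _ _
  have hN := outerLevel_le_self h0 h1 M
  have e1 := hspread (outerLevel ε M)
  have e2 := hspread (colLevel m n (outerLevel ε M))
  have e3 := hdev _ hN
  have e4 := hdev _ ((colLevel_le hm hmn (outerLevel ε M)).trans hN)
  refine (measureReal_union_le _ _).trans ?_
  refine (add_le_add (measureReal_union_le _ _) (measureReal_union_le _ _)).trans ?_
  linarith

/-! ### Asymptotics of the two scales -/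

theorem tendsto_outerLevel_div {ε : ℝ} (h1 : ε < 1) :
    Tendsto (fun M : ℕ => (outerLevel ε M : ℝ) / M) atTop (𝓝 (1 - ε)) :=
  (tendsto_nat_floor_mul_div_atTop (by linarith)).comp tendsto_natCast_atTop_atTop

theorem tendsto_outerLevel {ε : ℝ} (h1 : ε < 1) : Tendsto (outerLevel ε) atTop atTop :=
  tendsto_nat_floor_atTop.comp (tendsto_natCast_atTop_atTop.const_mul_atTop (by linarith))

theorem tendsto_runLength_div (hm : 2 ≤ m) (hmn : m < n) {ε : ℝ} (h0 : 0 < ε) (h1 : ε < 1) :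
    Tendsto (fun M : ℕ => (runLength m n ε M : ℝ) / outerLevel ε M) atTop
      (𝓝 (sigma m n * ε / (1 - ε))) := by
  have hs0 := sigma_pos hm hmn
  have h2 : Tendsto (fun M : ℕ => (runLength m n ε M : ℝ) / M) atTop (𝓝 (sigma m n * ε)) :=
    (tendsto_nat_floor_mul_div_atTop (by positivity)).comp tendsto_natCast_atTop_atTop
  refine (h2.div (tendsto_outerLevel_div h1) (by linarith)).congr' ?_
  filter_upwards [eventually_gt_atTop 0] with M hM
  have hM' : (M : ℝ) ≠ 0 := by exact_mod_cast hM.ne'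
  exact div_div_div_cancel_right₀ hM' _ _

theorem tendsto_runLength_div_colLevel (hm : 2 ≤ m) (hmn : m < n) {ε : ℝ} (h0 : 0 < ε)
    (h1 : ε < 1) :
    Tendsto (fun M : ℕ => (runLength m n ε M : ℝ) / colLevel m n (outerLevel ε M)) atTop
      (𝓝 (ε / (1 - ε))) := by
  have hs0 := sigma_pos hm hmn
  have h2 := (tendsto_runLength_div hm hmn h0 h1).div
    ((tendsto_colLevel_div hm hmn).comp (tendsto_outerLevel h1)) hs0.ne'
  rw [show sigma m n * ε / (1 - ε) / sigma m n = ε / (1 - ε) by field_simp] at h2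
  refine h2.congr' ?_
  filter_upwards [(tendsto_outerLevel h1).eventually_gt_atTop 0] with M hM
  have hM' : (outerLevel ε M : ℝ) ≠ 0 := by exact_mod_cast hM.ne'
  exact div_div_div_cancel_right₀ hM' _ _

theorem meanLog_colLevel [Nonempty D] (hm : 2 ≤ m) (hmn : m < n) (p : PMF D) {M N : ℕ}
    (hN : N ≤ colLevel m n M) :
    meanLog p M N =
      colLevel m n N * ∑ d : D, 1 / (D.card : ℝ) * Real.log (p d).toReal +
      (N - colLevel m n N) *
        ∑ i ∈ rows D, (rowCount D i : ℝ) / (D.card : ℝ) * Real.log (rowProb p i) := by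
  rw [← sum_range_ite (colLevel_le hm hmn N), meanLog]
  refine Finset.sum_congr rfl fun k hk => ?_
  rw [mixture_of_mem (show k ∈ Iio (colLevel m n M) from (Finset.mem_range.1 hk).trans_le hN)]
  unfold squareTerm
  split_ifs
  · exact sum_uniform_log p
  · exact sum_uniform_log_row p

theorem meanLog_of_le [Nonempty D] (hm : 2 ≤ m) (hmn : m < n) (p : PMF D) {M N : ℕ}
    (hN : colLevel m n M ≤ N) (hNM : N ≤ M) :
    meanLog p M N =
      colLevel m n N * ∑ d : D, 1 / (D.card : ℝ) * Real.log (p d).toReal +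
      (colLevel m n M - colLevel m n N) *
        ∑ i ∈ rows D, (rowCount D i : ℝ) / (D.card : ℝ) * Real.log (rowProb p i) +
      (N - colLevel m n M) *
        ∑ i ∈ rows D, 1 / ((rows D).card : ℝ) * Real.log (rowProb p i) := by
  set B := ∑ d : D, 1 / (D.card : ℝ) * Real.log (p d).toReal
  set Q₀ := ∑ i ∈ rows D, (rowCount D i : ℝ) / (D.card : ℝ) * Real.log (rowProb p i) with hQ₀
  set Q₁ := ∑ i ∈ rows D, 1 / ((rows D).card : ℝ) * Real.log (rowProb p i) with hQ₁
  have hmono := colLevel_mono hm hmn hNM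
  -- Below `⌈σM⌉` the digits are uniform, and as `⌈σN⌉ ≤ ⌈σM⌉ ≤ N` this covers all places at which
  -- `squareLog p N` involves the full digit.
  have hterm : ∀ k, ∑ d, (mixture D (Iio (colLevel m n M)) k d).toReal * squareTerm p N k d =
      (if k < colLevel m n N then B else Q₀) + if k < colLevel m n M then 0 else Q₁ - Q₀ := by
    intro k
    unfold squareTerm
    by_cases hk : k < colLevel m n M
    · rw [mixture_of_mem (show k ∈ Iio (colLevel m n M) from hk), if_pos hk, add_zero]
      split_ifs
      · exact sum_uniform_log p
      · exact sum_uniform_log_row p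
    · rw [mixture_of_notMem (show k ∉ Iio (colLevel m n M) from hk), if_neg hk,
        if_neg (by omega : ¬ k < colLevel m n N)]
      simp only [if_neg (by omega : ¬ k < colLevel m n N)]
      rw [sum_rowUniform_log_row, ← hQ₁]
      ring
  rw [meanLog]
  simp only [hterm]
  rw [Finset.sum_add_distrib, sum_range_ite (colLevel_le hm hmn N), sum_range_ite hN]
  ring

/-- For a typical point of a square the local exponents at the scales `N` and `⌈σN⌉` differ: at
the scale `N` the row digits in the second part of the word are uniform in the non-empty rows, at
the scale `⌈σN⌉` they come from uniform digits. -/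
theorem tendsto_meanLog_sub [Nonempty D] (hm : 2 ≤ m) (hmn : m < n) (p : PMF D) {ε : ℝ}
    (h0 : 0 < ε) (hε : ε < 1 - sigma m n) :
    Tendsto (fun M : ℕ => meanLog p M (outerLevel ε M) / outerLevel ε M -
      meanLog p M (colLevel m n (outerLevel ε M)) / colLevel m n (outerLevel ε M)) atTop
      (𝓝 ((1 - ε - sigma m n) / (1 - ε) *
        (∑ i ∈ rows D, 1 / ((rows D).card : ℝ) * Real.log (rowProb p i) -
          ∑ i ∈ rows D, (rowCount D i : ℝ) / (D.card : ℝ) * Real.log (rowProb p i)))) := by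
  have hs0 := sigma_pos hm hmn
  have h1 : ε < 1 := by linarith
  set B := ∑ d : D, 1 / (D.card : ℝ) * Real.log (p d).toReal with hB
  set Q₀ := ∑ i ∈ rows D, (rowCount D i : ℝ) / (D.card : ℝ) * Real.log (rowProb p i) with hQ₀
  set Q₁ := ∑ i ∈ rows D, 1 / ((rows D).card : ℝ) * Real.log (rowProb p i) with hQ₁
  have hN := tendsto_outerLevel h1
  have hc := tendsto_colLevel (m := m) (n := n) hm hmn
  have l1 := (tendsto_colLevel_div hm hmn).comp hN
  have l2 : Tendsto (fun M : ℕ => (colLevel m n M : ℝ) / outerLevel ε M) atTop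
      (𝓝 (sigma m n / (1 - ε))) := by
    refine ((tendsto_colLevel_div hm hmn).div (tendsto_outerLevel_div h1)
      (by linarith)).congr' ?_
    filter_upwards [eventually_gt_atTop 0] with M hM
    have hM' : (M : ℝ) ≠ 0 := by exact_mod_cast hM.ne'
    exact div_div_div_cancel_right₀ hM' _ _
  have l3 := (tendsto_colLevel_div hm hmn).comp (hc.comp hN)
  have l4 : ∀ᶠ M : ℕ in atTop, colLevel m n M ≤ outerLevel ε M := by
    have h2 : sigma m n / (1 - ε) < 1 := by
      rw [div_lt_one (by linarith)]
      linarith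
    filter_upwards [l2.eventually_lt_const h2, hN.eventually_gt_atTop 0] with M h3 h4
    have h4' : (0 : ℝ) < outerLevel ε M := by exact_mod_cast h4
    rw [div_lt_one h4'] at h3
    exact_mod_cast h3.le
  have l5 := (((l1.mul_const B).add ((l2.sub l1).mul_const Q₀)).add
    ((l2.const_sub 1).mul_const Q₁)).sub ((l3.mul_const B).add ((l3.const_sub 1).mul_const Q₀))
  have hval : sigma m n * B + (sigma m n / (1 - ε) - sigma m n) * Q₀ +
      (1 - sigma m n / (1 - ε)) * Q₁ - (sigma m n * B + (1 - sigma m n) * Q₀) =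
      (1 - ε - sigma m n) / (1 - ε) * (Q₁ - Q₀) := by
    have : 1 - ε ≠ 0 := by linarith
    field_simp
    ring
  rw [hval] at l5
  refine l5.congr' ?_
  filter_upwards [l4, hN.eventually_gt_atTop 0, (hc.comp hN).eventually_gt_atTop 0]
    with M h2 h3 h4
  have hNM := outerLevel_le_self h0 h1 M
  rw [meanLog_of_le hm hmn p h2 hNM, meanLog_colLevel hm hmn p (colLevel_mono hm hmn hNM),
    ← hB, ← hQ₀, ← hQ₁]
  have h3' : (outerLevel ε M : ℝ) ≠ 0 := by exact_mod_cast h3.ne'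
  have h4' : (colLevel m n (outerLevel ε M) : ℝ) ≠ 0 := by exact_mod_cast h4.ne'
  simp only [Function.comp]
  field_simp

/-- Typical sequences have different local exponents at the two scales. -/
theorem eventually_gap [Nonempty D] (hm : 2 ≤ m) (hmn : m < n) (p : PMF D) {ε g : ℝ}
    (h0 : 0 < ε) (hε : ε ≤ (1 - sigma m n) / 2) (hg0 : 0 < g)
    (hg : g = (1 - sigma m n) / 2 *
      |∑ i ∈ rows D, 1 / ((rows D).card : ℝ) * Real.log (rowProb p i) -
        ∑ i ∈ rows D, (rowCount D i : ℝ) / (D.card : ℝ) * Real.log (rowProb p i)|) :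
    ∀ᶠ M : ℕ in atTop, ∀ ω ∉ atypical p ε (g * sigma m n / 32) M,
      g / 2 ≤ |squareLog p (outerLevel ε M) ω / outerLevel ε M -
        squareLog p (colLevel m n (outerLevel ε M)) ω / colLevel m n (outerLevel ε M)| := by
  have hs0 := sigma_pos hm hmn
  have hs1 := sigma_lt_one hm hmn
  have h1 : ε < 1 := by linarith
  have hN := tendsto_outerLevel h1
  have hlim := (tendsto_meanLog_sub hm hmn p h0 (by linarith)).abs
  set Δ := ∑ i ∈ rows D, 1 / ((rows D).card : ℝ) * Real.log (rowProb p i) -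
    ∑ i ∈ rows D, (rowCount D i : ℝ) / (D.card : ℝ) * Real.log (rowProb p i)
  -- The means differ by more than `3g/4`, and the two deviations together are less than `g/4`.
  have hval : 3 / 4 * g < |(1 - ε - sigma m n) / (1 - ε) * Δ| := by
    rw [abs_mul, abs_of_nonneg (div_nonneg (by linarith) (by linarith))]
    have h2 : (1 - sigma m n) / 2 ≤ (1 - ε - sigma m n) / (1 - ε) := by
      rw [le_div_iff₀ (by linarith)]
      nlinarith
    have h3 := mul_le_mul_of_nonneg_right h2 (abs_nonneg Δ)
    linarith
  have r1 : Tendsto (fun M : ℕ => (M : ℝ) / outerLevel ε M) atTop (𝓝 (1 - ε)⁻¹) :=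
    ((tendsto_outerLevel_div h1).inv₀ (by linarith)).congr fun M => inv_div _ _
  have r2 : Tendsto (fun M : ℕ => (M : ℝ) / colLevel m n (outerLevel ε M)) atTop
      (𝓝 ((1 - ε)⁻¹ * (sigma m n)⁻¹)) := by
    refine (r1.mul ((((tendsto_colLevel_div hm hmn).comp hN).inv₀ hs0.ne').congr
      fun M => inv_div _ _)).congr' ?_
    filter_upwards [hN.eventually_gt_atTop 0] with M hM
    have hM' : (outerLevel ε M : ℝ) ≠ 0 := by exact_mod_cast hM.ne'
    exact div_mul_div_cancel₀ hM'
  have r3 := ((r1.add r2).const_mul (g * sigma m n / 32))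
  have hinv : (1 - ε)⁻¹ ≤ 2 := by
    rw [inv_le_comm₀ (by linarith) (by norm_num)]
    linarith
  have hr : g * sigma m n / 32 * ((1 - ε)⁻¹ + (1 - ε)⁻¹ * (sigma m n)⁻¹) < g / 4 := by
    have h2 : g * sigma m n / 32 * ((1 - ε)⁻¹ + (1 - ε)⁻¹ * (sigma m n)⁻¹) =
        g / 32 * (sigma m n + 1) * (1 - ε)⁻¹ := by field_simp
    rw [h2]
    have h3 : g / 32 * (sigma m n + 1) * (1 - ε)⁻¹ ≤ g / 32 * 2 * 2 := by
      gcongr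
      linarith
    linarith
  filter_upwards [hlim.eventually_const_lt hval, r3.eventually_lt_const hr,
    hN.eventually_gt_atTop 0, ((tendsto_colLevel hm hmn).comp hN).eventually_gt_atTop 0]
    with M e1 e2 e3 e4 ω hω
  simp only [atypical, mem_union, mem_ofPred_eq, not_or, not_le] at hω
  obtain ⟨-, f1, f2⟩ := hω
  set N := outerLevel ε M
  have e3' : (0 : ℝ) < N := by exact_mod_cast e3
  have e4' : (0 : ℝ) < colLevel m n N := by exact_mod_cast e4
  have f1' : |squareLog p N ω / N - meanLog p M N / N| ≤ g * sigma m n / 32 * (M / N) := by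
    rw [← sub_div, abs_div, abs_of_pos e3', ← mul_div_assoc]
    gcongr
  have f2' : |squareLog p (colLevel m n N) ω / colLevel m n N -
      meanLog p M (colLevel m n N) / colLevel m n N| ≤
      g * sigma m n / 32 * (M / colLevel m n N) := by
    rw [← sub_div, abs_div, abs_of_pos e4', ← mul_div_assoc]
    gcongr
  generalize squareLog p N ω / N = a at *
  generalize squareLog p (colLevel m n N) ω / colLevel m n N = b at *
  generalize meanLog p M N / N = a' at *
  generalize meanLog p M (colLevel m n N) / colLevel m n N = b' at *
  have h2 : |a' - b'| ≤ |a - b| + |a - a'| + |b - b'| := by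
    have : a' - b' = (a - b) - (a - a') + (b - b') := by ring
    rw [this]
    exact (abs_add_le _ _).trans (add_le_add_left (abs_sub _ _) _)
  rw [mul_add] at e2
  linarith

end TwoScales

/-! ### Level sets of smaller packing dimension -/

section SmallerDimension

variable {m n : ℕ} {D : Finset (Fin m × Fin n)}

/-- A limit of `b r / log r` gives the growth of `b` along a sequence of radii that decays like
`exp (-κ N)`. -/
theorem tendsto_log_div_of_tendsto {b : ℝ → ℝ} {α κ : ℝ} (hκ : 0 < κ)
    (hb : Tendsto (fun r => b r / Real.log r) (𝓝[>] 0) (𝓝 α)) {N : ℕ → ℕ}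
    (hN : Tendsto N atTop atTop) {r : ℕ → ℝ} (hr : ∀ M, 0 < r M)
    (hrN : Tendsto (fun M => Real.log (r M) / N M) atTop (𝓝 (-κ))) :
    Tendsto (fun M => b (r M) / N M) atTop (𝓝 (α * -κ)) := by
  have hN' : Tendsto (fun M => (N M : ℝ)) atTop atTop := tendsto_natCast_atTop_atTop.comp hN
  have hlog : Tendsto (fun M => Real.log (r M)) atTop atBot := by
    refine (hrN.neg_mul_atTop (neg_lt_zero.2 hκ) hN').congr' ?_
    filter_upwards [hN'.eventually_gt_atTop 0] with M hM
    exact div_mul_cancel₀ _ hM.ne'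
  have hr0 : Tendsto r atTop (𝓝[>] 0) := by
    refine tendsto_nhdsWithin_iff.2 ⟨?_, Eventually.of_forall hr⟩
    exact (Real.tendsto_exp_atBot.comp hlog).congr fun M => Real.exp_log (hr M)
  refine ((hb.comp hr0).mul hrN).congr' ?_
  filter_upwards [hlog.eventually_lt_atBot 0] with M hM
  exact div_mul_div_cancel₀ hM.ne

theorem tendsto_log_outer_radius (hm : 2 ≤ m) {N : ℕ → ℕ} (hN : Tendsto N atTop atTop) :
    Tendsto (fun M => Real.log (2 / (m : ℝ) ^ N M) / N M) atTop (𝓝 (-Real.log m)) := by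
  have hm0 : (0 : ℝ) < m := by positivity
  have hN' : Tendsto (fun M => (N M : ℝ)) atTop atTop := tendsto_natCast_atTop_atTop.comp hN
  have h := (tendsto_const_nhds (x := Real.log 2)).div_atTop hN' |>.sub_const (Real.log m)
  rw [zero_sub] at h
  refine h.congr' ?_
  filter_upwards [hN'.eventually_gt_atTop 0] with M hM
  rw [Real.log_div (by norm_num) (by positivity), Real.log_pow]
  field_simp

theorem tendsto_log_inner_radius (hm : 2 ≤ m) (hmn : m < n) {N l : ℕ → ℕ}
    (hN : Tendsto N atTop atTop) {ℓ : ℝ}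
    (hl : Tendsto (fun M => (l M : ℝ) / N M) atTop (𝓝 ℓ)) :
    Tendsto (fun M => Real.log (1 / (2 * ((m : ℝ) ^ N M * (n : ℝ) ^ (l M + 1)))) / N M) atTop
      (𝓝 (-(Real.log m + ℓ * Real.log n))) := by
  have hm0 : (0 : ℝ) < m := by positivity
  have hn0 : (0 : ℝ) < n := by exact_mod_cast (by omega : 0 < n)
  have hN' : Tendsto (fun M => (N M : ℝ)) atTop atTop := tendsto_natCast_atTop_atTop.comp hN
  have h := (((hl.mul_const (Real.log n)).const_add (Real.log m)).add
    ((tendsto_const_nhds (x := Real.log 2 + Real.log n)).div_atTop hN')).neg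
  rw [add_zero] at h
  refine h.congr' ?_
  filter_upwards [hN'.eventually_gt_atTop 0] with M hM
  rw [one_div, Real.log_inv, Real.log_mul (by norm_num) (by positivity), Real.log_mul
    (by positivity) (by positivity), Real.log_pow, Real.log_pow]
  push_cast
  field_simp
  ring

theorem localDimension_nonneg {μ : Measure (EuclideanSpace ℝ (Fin 2))} [IsProbabilityMeasure μ]
    {x : EuclideanSpace ℝ (Fin 2)} {α : ℝ}
    (hα : Tendsto (fun r : ℝ => Real.log (μ.real (Metric.closedBall x r)) / Real.log r) (𝓝[>] 0)
      (𝓝 α)) : 0 ≤ α := by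
  refine ge_of_tendsto hα ?_
  filter_upwards [Real.tendsto_log_nhdsGT_zero.eventually_lt_atBot 0] with r hr
  exact div_nonneg_of_nonpos (Real.log_nonpos measureReal_nonneg measureReal_le_one) hr.le

/-- Local dimensions are bounded, since approximate squares of level `N` have at least
exponentially small measure. -/
theorem localDimension_mul_log_le (hm : 2 ≤ m) (hmn : m < n) {p : PMF D} (hp : ∀ d, p d ≠ 0)
    {C : ℝ} (hC : ∀ N k d, |squareTerm p N k d| ≤ C) {ω : ℕ → D} {α : ℝ}
    (hα : Tendsto (fun r : ℝ => Real.log ((bernoulliMeasure D p).real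
      (Metric.closedBall (codingMap D ω) r)) / Real.log r) (𝓝[>] 0) (𝓝 α)) :
    α * Real.log m ≤ C := by
  have hm0 : (0 : ℝ) < m := by positivity
  have hlm : 0 < Real.log m := Real.log_pos (by exact_mod_cast hm)
  have h := tendsto_log_div_of_tendsto hlm hα tendsto_id
    (r := fun N => 2 / (m : ℝ) ^ N) (fun N => by positivity)
    (tendsto_log_outer_radius hm tendsto_id)
  have : -C ≤ α * -Real.log m := by
    refine ge_of_tendsto h ?_
    filter_upwards [eventually_gt_atTop 0] with N hN
    have hN' : (0 : ℝ) < N := by exact_mod_cast hN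
    have h1 := Real.log_le_log (Real.exp_pos _)
      (le_bernoulliMeasure_closedBall hm hmn hp (le_refl (2 / (m : ℝ) ^ N)) ω)
    rw [Real.log_exp] at h1
    have h2 : -C * N ≤ squareLog p N ω := by
      rw [mul_comm, ← nsmul_eq_mul]
      exact (by simp : N • -C = ∑ k ∈ Finset.range N, -C).trans_le
        (Finset.sum_le_sum fun k _ => (abs_le.1 (hC N k (ω k))).1)
    rw [id_eq, le_div_iff₀ hN']
    exact h2.trans h1
  linarith

/-- At the scales at which a point is well inside its approximate square, the measure of the
square is determined by the local dimension, up to an error proportional to the length of the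
excluded runs. -/
theorem eventually_abs_squareLog_le (hm : 2 ≤ m) (hmn : m < n) {p : PMF D} (hp : ∀ d, p d ≠ 0)
    {ω : ℕ → D} {α : ℝ}
    (hα : Tendsto (fun r : ℝ => Real.log ((bernoulliMeasure D p).real
      (Metric.closedBall (codingMap D ω) r)) / Real.log r) (𝓝[>] 0) (𝓝 α))
    {N l : ℕ → ℕ} (hN : Tendsto N atTop atTop) {ℓ : ℝ} (hℓ : 0 ≤ ℓ)
    (hl : Tendsto (fun M => (l M : ℝ) / N M) atTop (𝓝 ℓ)) {η : ℝ} (hη : 0 < η) :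
    ∀ᶠ M in atTop, Spread (N M) (l M) ω →
      |squareLog p (N M) ω / N M + α * Real.log m| ≤ α * ℓ * Real.log n + η := by
  have hm0 : (0 : ℝ) < m := by positivity
  have hn0 : (0 : ℝ) < n := by exact_mod_cast (by omega : 0 < n)
  have hlm : 0 < Real.log m := Real.log_pos (by exact_mod_cast hm)
  have hln : 0 < Real.log n := Real.log_pos (by exact_mod_cast (by omega : 1 < n))
  have := isProbabilityMeasure_bernoulliMeasure (D := D) hm (by omega : 2 ≤ n) p
  have hα0 : 0 ≤ α := localDimension_nonneg hα
  have hprod : 0 ≤ α * ℓ * Real.log n := by positivity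
  have h1 := tendsto_log_div_of_tendsto hlm hα hN (r := fun M => 2 / (m : ℝ) ^ N M)
    (fun M => by positivity) (tendsto_log_outer_radius hm hN)
  have h2 := tendsto_log_div_of_tendsto (by positivity) hα hN
    (r := fun M => 1 / (2 * ((m : ℝ) ^ N M * (n : ℝ) ^ (l M + 1))))
    (fun M => by positivity) (tendsto_log_inner_radius hm hmn hN hl)
  filter_upwards [h1.eventually_lt_const (lt_add_of_pos_right _ hη),
    h2.eventually_const_lt (sub_lt_self _ hη), hN.eventually_gt_atTop 0] with M e1 e2 e3 hsp
  have e3' : (0 : ℝ) < N M := by exact_mod_cast e3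
  set r : ℝ := 1 / (2 * ((m : ℝ) ^ N M * (n : ℝ) ^ (l M + 1))) with hr
  have hr0 : 0 < r := by positivity
  have hpos : 0 < (bernoulliMeasure D p).real (Metric.closedBall (codingMap D ω) r) := by
    obtain ⟨K, hK⟩ := pow_unbounded_of_one_lt (2 / r) (by exact_mod_cast hm : (1 : ℝ) < m)
    refine (Real.exp_pos _).trans_le (le_bernoulliMeasure_closedBall hm hmn hp (N := K) ?_ ω)
    rw [div_le_comm₀ (by positivity) hr0]
    exact hK.le
  have f1 := Real.log_le_log (Real.exp_pos _)
    (le_bernoulliMeasure_closedBall hm hmn hp (le_refl (2 / (m : ℝ) ^ N M)) ω)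
  have f2 := Real.log_le_log hpos (bernoulliMeasure_closedBall_le hm hmn hp (N := N M) (l := l M)
    (by
      rw [hr]
      refine one_div_lt_one_div_of_lt (by positivity) ?_
      have : 0 < (m : ℝ) ^ N M * (n : ℝ) ^ (l M + 1) := by positivity
      linarith) hsp)
  rw [Real.log_exp] at f1 f2
  have g1 := div_le_div_of_nonneg_right f1 e3'.le
  have g2 := div_le_div_of_nonneg_right f2 e3'.le
  rw [abs_le]
  constructor <;> linarith

variable [Nonempty D]

theorem dimP_eventually_atypical_lt (hm : 2 ≤ m) (hmn : m < n) (hD : 2 ≤ D.card) {p : PMF D}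
    (hp : ∀ d, p d ≠ 0) {code : EuclideanSpace ℝ (Fin 2) → ℕ → D}
    (hcode : ∀ x ∈ carpet D, codingMap D (code x) = x) {ε η : ℝ} (h0 : 0 < ε) (h1 : ε < 1)
    (hη : 0 < η) : dimP {x ∈ carpet D | ∀ᶠ M in atTop, code x ∈ atypical p ε η M} <
      dimP (carpet D) := by
  obtain ⟨K, c, hc, hK⟩ := exists_atypical_bound hm hmn hp h0 h1 hη
  have hlm : 0 < Real.log m := Real.log_pos (by exact_mod_cast hm)
  have hL1 : (1 : ℝ) ≤ (rows D).card := by exact_mod_cast card_rows_pos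
  have hE : 0 < squareEntropy D := by
    have e1 : 0 < Real.log D.card := Real.log_pos (by exact_mod_cast hD)
    have e2 := Real.log_nonneg hL1
    have e3 := sigma_pos hm hmn
    have e4 := sigma_lt_one hm hmn
    have := mul_pos e3 e1
    have := mul_nonneg (sub_pos.2 e4).le e2
    unfold squareEntropy
    linarith
  refine (dimP_le_of_eventually_mem hm hmn hcode _
    (fun M ω hω => symbSquare_subset_atypical hm hmn p h0 h1 M hω) hK).trans_lt
    (lt_of_lt_of_le ?_ (le_dimP_carpet hm hmn))
  rw [ENNReal.ofReal_lt_ofReal_iff (by positivity)]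
  gcongr
  linarith

/-- Along a symbolic level set the exponents at the two scales have the same limit, so the codes
are eventually atypical. -/
theorem symbLevelSet_subset (hm : 2 ≤ m) (hmn : m < n) {p : PMF D} (hp : ∀ d, p d ≠ 0)
    {code : EuclideanSpace ℝ (Fin 2) → ℕ → D} (hcode : ∀ x ∈ carpet D, codingMap D (code x) = x)
    {ε η g : ℝ} (h1 : ε < 1) (hg : 0 < g)
    (hgap : ∀ᶠ M : ℕ in atTop, ∀ ω ∉ atypical p ε η M,
      g / 2 ≤ |squareLog p (outerLevel ε M) ω / outerLevel ε M -
        squareLog p (colLevel m n (outerLevel ε M)) ω / colLevel m n (outerLevel ε M)|) (α : ℝ) :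
    symbLevelSet D p code α ⊆ {x ∈ carpet D | ∀ᶠ M in atTop, code x ∈ atypical p ε η M} := by
  rintro x ⟨hx, hlim⟩
  refine ⟨hx, ?_⟩
  have hlm : 0 < Real.log m := Real.log_pos (by exact_mod_cast hm)
  simp only [bernoulliMeasure_approxSquare hm hmn hp hcode, Real.log_exp] at hlim
  have hlim' : Tendsto (fun N : ℕ => squareLog p N (code x) / N) atTop (𝓝 (α * -Real.log m)) := by
    refine (hlim.mul_const (-Real.log m)).congr fun N => ?_
    rcases eq_or_ne (N : ℝ) 0 with h | h
    · simp [h]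
    · field_simp
  have hN := tendsto_outerLevel h1
  have hdiff := ((hlim'.comp hN).sub (hlim'.comp ((tendsto_colLevel hm hmn).comp hN))).abs
  rw [sub_self, abs_zero] at hdiff
  filter_upwards [hgap, hdiff.eventually_lt_const (half_pos hg)] with M e1 e2
  by_contra hnot
  exact absurd (e1 _ hnot) (not_le.2 e2)

/-- The analogue of `symbLevelSet_subset` for balls. Only at typical points is the measure of a
square comparable with that of a ball, but typical points are the ones to be excluded. -/
theorem realLevelSet_subset (hm : 2 ≤ m) (hmn : m < n) {p : PMF D} (hp : ∀ d, p d ≠ 0)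
    {code : EuclideanSpace ℝ (Fin 2) → ℕ → D} (hcode : ∀ x ∈ carpet D, codingMap D (code x) = x)
    {ε η g C : ℝ} (h0 : 0 < ε) (h1 : ε ≤ 1 / 2) (hg : 0 < g)
    (hC : ∀ N k d, |squareTerm p N k d| ≤ C)
    (hε : 4 * ε * (C / Real.log m) * Real.log n ≤ g / 4)
    (hgap : ∀ᶠ M : ℕ in atTop, ∀ ω ∉ atypical p ε η M,
      g / 2 ≤ |squareLog p (outerLevel ε M) ω / outerLevel ε M -
        squareLog p (colLevel m n (outerLevel ε M)) ω / colLevel m n (outerLevel ε M)|) (α : ℝ) :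
    realLevelSet D p α ⊆ {x ∈ carpet D | ∀ᶠ M in atTop, code x ∈ atypical p ε η M} := by
  rintro x ⟨hx, hlim⟩
  refine ⟨hx, ?_⟩
  have hlm : 0 < Real.log m := Real.log_pos (by exact_mod_cast hm)
  have hln : 0 < Real.log n := Real.log_pos (by exact_mod_cast (by omega : 1 < n))
  have hs0 := sigma_pos hm hmn
  have hs1 := sigma_lt_one hm hmn
  have h1' : ε < 1 := by linarith
  rw [← hcode x hx] at hlim
  have := isProbabilityMeasure_bernoulliMeasure (D := D) hm (by omega : 2 ≤ n) p
  have hα0 : 0 ≤ α := localDimension_nonneg hlim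
  have hα1 : α ≤ C / Real.log m := by
    rw [le_div_iff₀ hlm]
    exact localDimension_mul_log_le hm hmn hp hC hlim
  have hN := tendsto_outerLevel h1'
  have hε2 : ε / (1 - ε) ≤ 2 * ε := by
    rw [div_le_iff₀ (by linarith)]
    nlinarith
  have hε1 : sigma m n * ε / (1 - ε) ≤ 2 * ε := by
    refine le_trans ?_ hε2
    exact div_le_div_of_nonneg_right (mul_le_of_le_one_left h0.le hs1.le) (by linarith)
  have hbound : ∀ ℓ ≤ 2 * ε, α * ℓ * Real.log n ≤ g / 8 := fun ℓ hℓ =>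
    calc α * ℓ * Real.log n ≤ α * (2 * ε) * Real.log n := by gcongr
      _ ≤ (C / Real.log m) * (2 * ε) * Real.log n := by gcongr
      _ ≤ g / 8 := by linarith
  -- The choice of `ε` makes the errors at both scales small compared with the gap `g`.
  filter_upwards [hgap,
    eventually_abs_squareLog_le hm hmn hp hlim hN (div_nonneg (by positivity) (by linarith))
      (tendsto_runLength_div hm hmn h0 h1') (by positivity : 0 < g / 16),
    eventually_abs_squareLog_le hm hmn hp hlim ((tendsto_colLevel hm hmn).comp hN)
      (div_nonneg h0.le (by linarith))
      (tendsto_runLength_div_colLevel hm hmn h0 h1') (by positivity : 0 < g / 16)]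
    with M e1 e2 e3
  by_contra hnot
  have e4 := e1 _ hnot
  simp only [atypical, mem_union, mem_ofPred_eq, not_or, not_not] at hnot
  have e5 := (e2 hnot.1.1).trans (add_le_add_left (hbound _ hε1) _)
  have e6 := (e3 hnot.1.2).trans (add_le_add_left (hbound _ hε2) _)
  simp only [Function.comp] at e6
  have e7 := abs_sub_le (squareLog p (outerLevel ε M) (code x) / outerLevel ε M)
    (-(α * Real.log m))
    (squareLog p (colLevel m n (outerLevel ε M)) (code x) / colLevel m n (outerLevel ε M))
  rw [sub_neg_eq_add, abs_sub_comm (-(α * Real.log m)), sub_neg_eq_add] at e7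
  linarith

/-- If uniform digits and digits with uniform rows give different mean exponents to the rows, then
all level sets, for all `α`, lie in one set of smaller packing dimension than the carpet. -/
theorem iSup_dimP_levelSet_lt (hm : 2 ≤ m) (hmn : m < n) (hD : 2 ≤ D.card) {p : PMF D}
    (hp : ∀ d, p d ≠ 0) {code : EuclideanSpace ℝ (Fin 2) → ℕ → D}
    (hcode : ∀ x ∈ carpet D, codingMap D (code x) = x)
    (hne : ∑ i ∈ rows D, 1 / ((rows D).card : ℝ) * Real.log (rowProb p i) ≠
      ∑ i ∈ rows D, (rowCount D i : ℝ) / (D.card : ℝ) * Real.log (rowProb p i)) :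
    (⨆ α : ℝ, dimP (symbLevelSet D p code α)) < dimP (carpet D) ∧
      (⨆ α : ℝ, dimP (realLevelSet D p α)) < dimP (carpet D) := by
  obtain ⟨C, hC0, hC⟩ := exists_abs_squareTerm_le hp
  have hlm : 0 < Real.log m := Real.log_pos (by exact_mod_cast hm)
  have hln : 0 < Real.log n := Real.log_pos (by exact_mod_cast (by omega : 1 < n))
  have hs0 := sigma_pos hm hmn
  have hs1 := sub_pos.2 (sigma_lt_one hm hmn)
  obtain ⟨g, hg⟩ : ∃ g, g = (1 - sigma m n) / 2 *
      |∑ i ∈ rows D, 1 / ((rows D).card : ℝ) * Real.log (rowProb p i) -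
        ∑ i ∈ rows D, (rowCount D i : ℝ) / (D.card : ℝ) * Real.log (rowProb p i)| := ⟨_, rfl⟩
  have hg0 : 0 < g := by
    have := abs_pos.2 (sub_ne_zero.2 hne)
    rw [hg]
    positivity
  set ε := min ((1 - sigma m n) / 2) (g * Real.log m / (16 * C * Real.log n)) with hε
  have h0 : 0 < ε := by positivity
  have hε1 : ε ≤ (1 - sigma m n) / 2 := min_le_left _ _
  have hε2 : 4 * ε * (C / Real.log m) * Real.log n ≤ g / 4 := by
    have h := min_le_right ((1 - sigma m n) / 2) (g * Real.log m / (16 * C * Real.log n))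
    rw [← hε, le_div_iff₀ (by positivity)] at h
    rw [mul_div_assoc', div_mul_eq_mul_div, div_le_iff₀ hlm]
    linarith
  have hgap := eventually_gap hm hmn p h0 hε1 hg0 hg
  have hlt := dimP_eventually_atypical_lt hm hmn hD hp hcode h0 (by linarith : ε < 1)
    (by positivity : 0 < g * sigma m n / 32)
  exact ⟨(iSup_le fun α => dimP_mono
      (symbLevelSet_subset hm hmn hp hcode (by linarith) hg0 hgap α)).trans_lt hlt,
    (iSup_le fun α => dimP_mono
      (realLevelSet_subset hm hmn hp hcode h0 (by linarith) hg0 hC hε2 hgap α)).trans_lt hlt⟩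

end SmallerDimension

theorem theorem2p3 {m n : ℕ} (hm : 2 ≤ m) (hmn : m < n) (D : Finset (Fin m × Fin n))
    (hD : 2 ≤ D.card) (p : PMF D) (hp : ∀ d, p d ≠ 0)
    (code : EuclideanSpace ℝ (Fin 2) → ℕ → D)
    (hcode : ∀ x ∈ carpet D, codingMap D (code x) = x) :
    ((∑ i ∈ rows D, 1 / ((rows D).card : ℝ) * Real.log (rowProb p i) ≠
        ∑ i ∈ rows D, (rowCount D i : ℝ) / (D.card : ℝ) * Real.log (rowProb p i)) →
      (⨆ α : ℝ, dimP (symbLevelSet D p code α)) < dimP (carpet D) ∧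
      (⨆ α : ℝ, dimP (realLevelSet D p α)) < dimP (carpet D)) ∧
    (∀ A B : ℝ,
      ∑ i ∈ rows D, 1 / ((rows D).card : ℝ) * Real.log (rowProb p i) = A →
      ∑ i ∈ rows D, (rowCount D i : ℝ) / (D.card : ℝ) * Real.log (rowProb p i) = A →
      ∑ d : D, 1 / (D.card : ℝ) * Real.log (p d).toReal = B →
      ∑ d : D, 1 / ((rowCount D d.1.1 : ℝ) * ((rows D).card : ℝ)) * Real.log (p d).toReal = B →
      dimP (symbLevelSet D p code
          (-(1 / Real.log m) * (sigma m n * B + (1 - sigma m n) * A))) = dimP (carpet D) ∧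
      dimP (realLevelSet D p
          (-(1 / Real.log m) * (sigma m n * B + (1 - sigma m n) * A))) = dimP (carpet D)) := by
  have : Nonempty D := (Finset.card_pos.1 (by omega)).to_subtype
  refine ⟨fun hne => iSup_dimP_levelSet_lt hm hmn hD hp hcode hne, fun A B hA1 hA2 hB1 hB2 => ?_⟩
  have hΦ := ae_tendsto_squareLog_div hm hmn hp (blockSet m n) hA1 hA2 hB1 hB2
  exact ⟨dimP_eq_carpet_of_ae_mem hm hmn hcode (fun x hx => hx.1)
      (ae_mem_symbLevelSet hm hmn hp hcode hΦ),
    dimP_eq_carpet_of_ae_mem hm hmn hcode (fun x hx => hx.1) (ae_mem_realLevelSet hm hmn hp hΦ)⟩
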